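/- Let $r\ge 1$ be an integer and let $\lambda$ be a partition (of arbitrary weight $|\lambda|$, possibly empty). Notation. For $k\ge 0$ let $h_k(\mathbf t)\in\mathbb C[t_1,t_2,\dots]$ be defined by $\sum_{k\ge 0}h_k(\mathbf t)z^k=\exp\bigl(\sum_{j\ge 1}t_jz^j\bigr)$, put $h_k=0$ for $k<0$, and let $s_\lambda(\mathbf t)=\det_{1\le i,j\le \ell(\lambda)}\bigl(h_{\lambda_i-i+j}(\mathbf t)\bigr)$ be the Schur polynomial in these variables. Let $$\operatorname{Cyc}_r(t_1,\dots,t_r)=\frac1{r!}\sum_{|\mu|=r}|C_\mu|\prod_{i=1}^{\ell(\mu)}t_{\mu_i}$$ be the cycle index polynomial of the symmetric group $S_r$, where $C_\mu\subset S_r$ is the conjugacy class of permutations of cycle type $\mu$. If $|\lambda|=rn$, let $g_\lambda^{(r)}$ be the number of semistandard Young tableaux of shape $\lambda$ and content $1^r2^r\cdots n^r$. Let $dA$ be the area measure on $\mathbb C$. Let $\bar v$ be a formal indeterminate. The function $s_\lambda(t_1,\dots,t_r,0,\dots)\,e^{\bar v^r\overline{\operatorname{Cyc}_r(t_1,\dots,t_r)}}$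 is regarded as a formal power series in $\bar v$, whose coefficients are polynomials in $t_1,\dots,t_r,\bar t_1,\dots,\bar t_r$, and its integral is taken coefficient by coefficient. Then every coefficient is integrable against $\prod_{j=1}^re^{-|t_j|^2}dA(t_j)$ over $\mathbb C^r$, and, as an identity in $\mathbb C[[\bar v]]$, $$\frac1{\pi^r}\int_{\mathbb C}\cdots\int_{\mathbb C}s_\lambda(t_1,\dots,t_r,0,\dots)\,e^{\bar v^r\overline{\operatorname{Cyc}_r(t_1,\dots,t_r)}}\prod_{j=1}^re^{-|t_j|^2}dA(t_j)=\begin{cases}\dfrac{\bar v^{rn}}{n!}\,g_\lambda^{(r)} & \text{if } |\lambda|=rn \text{ for an integer } n\ge 0,\\[2mm] 0 & \text{if } r\nmid|\lambda|.\end{cases}$$ -/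

import Mathlib

open scoped PowerSeries

noncomputable section

namespace LabelCropping

/-- The polynomial ring `ℂ[t₁, t₂, t₃, …]`. -/
abbrev TPoly : Type := MvPolynomial ℕ+ ℂ

/-- The indeterminate `t_j` for `j ≥ 1`; by convention `t₀ = 0`. -/
def tVar (j : ℕ) : TPoly :=
  if h : 0 < j then MvPolynomial.X ⟨j, h⟩ else 0

/-- The formal series `∑_{j ≥ 1} t_j z^j` in the variable `z`. -/
def tSeries : TPoly⟦X⟧ :=
  PowerSeries.mk tVar

/-- `∑_{j ≥ 1} t_j z^j` has no constant term, so it may be substituted into power series. -/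
theorem hasSubst_tSeries : PowerSeries.HasSubst tSeries :=
  PowerSeries.HasSubst.of_constantCoeff_zero' (by
    rw [← PowerSeries.coeff_zero_eq_constantCoeff_apply]; simp [tSeries, tVar])

/-- The polynomials `h_k(t)`, defined by `∑_{k ≥ 0} h_k(t) z^k = exp (∑_{j ≥ 1} t_j z^j)`. -/
def hPoly (k : ℕ) : TPoly :=
  PowerSeries.coeff k ((PowerSeries.exp TPoly).subst tSeries)

/-- `h_k(t)` for integer `k`, with `h_k(t) = 0` for `k < 0`. -/
def hPolyInt (k : ℤ) : TPoly :=
  if 0 ≤ k then hPoly k.toNat else 0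

/-- The Schur polynomial `s_λ(t) = det (h_{λ_i - i + j}(t))_{1 ≤ i, j ≤ ℓ(λ)}` in the normalized
power sum variables. Row lengths `λ_i` and indices are counted from `0` here, which does not
change `j - i`; the length `ℓ(λ)` is the length of the first column. -/
def schurPoly (μ : YoungDiagram) : TPoly :=
  Matrix.det (Matrix.of fun i j : Fin (μ.colLen 0) =>
    hPolyInt ((μ.rowLen i : ℤ) - (i : ℤ) + (j : ℤ)))

/-- `|C_μ|`: the number of permutations in `S_r` of cycle type `μ` (fixed points counted as
parts equal to `1`). -/
def conjClassCard {r : ℕ} (μ : r.Partition) : ℕ :=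
  Nat.card {σ : Equiv.Perm (Fin r) // σ.partition.parts = μ.parts}

/-- The cycle index polynomial of the symmetric group `S_r`,
`Cyc_r(t) = (1 / r!) ∑_{|μ| = r} |C_μ| ∏_i t_{μ_i}`; only `t₁, …, t_r` occur in it. -/
def cycPoly (r : ℕ) : TPoly :=
  MvPolynomial.C (1 / (r.factorial : ℂ)) *
    ∑ μ : r.Partition, (conjClassCard μ : TPoly) * (μ.parts.map tVar).prod

/-- The point `(t₁, …, t_r, 0, 0, …)`; the coordinate `t_j` is `t ⟨j - 1, _⟩`. -/
def crop {r : ℕ} (t : Fin r → ℂ) (j : ℕ+) : ℂ :=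
  if h : (j : ℕ) - 1 < r then t ⟨(j : ℕ) - 1, h⟩ else 0

/-- The value `P(t₁, …, t_r, 0, 0, …)`. -/
def evalCrop {r : ℕ} (t : Fin r → ℂ) (P : TPoly) : ℂ :=
  MvPolynomial.eval (crop t) P

/-- `g_λ^{(r)}`: the number of semistandard Young tableaux of shape `λ` and content
`1^r 2^r ⋯ n^r`. The letters `1, …, n` are represented by `0, …, n - 1`. -/
def rectKostka (μ : YoungDiagram) (r n : ℕ) : ℕ :=
  Nat.card {T : SemistandardYoungTableau μ //
    ∀ k : ℕ, (μ.cells.filter fun c => T c.1 c.2 = k).card = if k < n then r else 0}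

/-- The formal power series `exp (v̄^r · conj (Cyc_r(t₁, …, t_r)))` in the indeterminate `v̄`
(the variable `X`), for a given point `t ∈ ℂ^r`. -/
def expConjCyc {r : ℕ} (t : Fin r → ℂ) : ℂ⟦X⟧ :=
  (PowerSeries.exp ℂ).subst
    (PowerSeries.C (starRingEnd ℂ (evalCrop t (cycPoly r))) * (PowerSeries.X : ℂ⟦X⟧) ^ r)

/-- For `r ≥ 1` the series `c v̄^r` may be substituted into power series. -/
theorem hasSubst_C_mul_X_pow {r : ℕ} (hr : 1 ≤ r) (c : ℂ) :
    PowerSeries.HasSubst (PowerSeries.C c * (PowerSeries.X : ℂ⟦X⟧) ^ r) :=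
  PowerSeries.HasSubst.of_constantCoeff_zero' (by
    simp [show r ≠ 0 by omega])

/-- The formal power series `s_λ(t₁, …, t_r, 0, …) · exp (v̄^r · conj (Cyc_r(t₁, …, t_r)))` in the
indeterminate `v̄`, for a given point `t ∈ ℂ^r`. -/
def integrand (μ : YoungDiagram) {r : ℕ} (t : Fin r → ℂ) : ℂ⟦X⟧ :=
  PowerSeries.C (evalCrop t (schurPoly μ)) * expConjCyc t

/-- The Gaussian weight `∏_j exp (-|t_j|²)`. -/
def gaussWeight {r : ℕ} (t : Fin r → ℂ) : ℂ :=
  ∏ j : Fin r, ((Real.exp (-‖t j‖ ^ 2) : ℝ) : ℂ)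

/-- The coefficients of a family of formal power series are integrable against the Gaussian
weight over `ℂ^r`. -/
def GaussIntegrable {r : ℕ} (F : (Fin r → ℂ) → ℂ⟦X⟧) : Prop :=
  ∀ l : ℕ, MeasureTheory.Integrable
    (fun t : Fin r → ℂ => PowerSeries.coeff l (F t) * gaussWeight t) MeasureTheory.volume

/-- The Gaussian integral `π^{-r} ∫_{ℂ^r} F(t) ∏_j exp (-|t_j|²) dA(t_j)` of a family of formal
power series, taken coefficient by coefficient. -/
def gaussIntegral {r : ℕ} (F : (Fin r → ℂ) → ℂ⟦X⟧) : ℂ⟦X⟧ :=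
  PowerSeries.mk fun l =>
    (1 / (Real.pi : ℂ) ^ r) *
      ∫ t : Fin r → ℂ, PowerSeries.coeff l (F t) * gaussWeight t

end LabelCropping

end

/-!
In the variables `t_j = p_j / j` the Hall inner product of symmetric functions pairs `t_j` with
`p_j`. The Gaussian measure pairs `t_j` with itself, so integrating `P(t) conj(Q(t))` gives the Hall
inner product of `P` with the symmetric function obtained from `Q` by putting `t_j = p_j`. For
`Q = Cyc_r` this is the complete symmetric function `h_r`, and the coefficient of `v̄^{rn}` in the
integral is `⟨s_λ, h_r^n⟩ / n!`. The inner product `⟨s_λ, h_r^n⟩` is the coefficient of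
`x₁^r ⋯ x_n^r` in `s_λ`, and it counts the tableaux of content `1^r ⋯ n^r`.

The proof uses one variable `x` at a time. The translation `t_j ↦ t_j + x^j / j` (`shift`) adjoins a
variable to a symmetric function, and `skew k` takes the coefficient of `x^k` in the result.

* Gaussian moments are orthogonal, so multiplication by `t_j` is adjoint to `∂/∂t_j`
  (`pairing_mul_X`). As `k Cyc_k = ∑ t_j Cyc_{k-j}` (`natCast_mul_cycPoly`) and
  `k skew_k = ∑ skew_{k-j} ∂/∂t_j` (`natCast_mul_skew`), multiplication by `Cyc_k` is adjoint to
  `skew k` for `k ≤ r` (`pairing_mul_cycPoly`). Setting `t_j = 0` for `j > r` does no harm, because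
  only `t₁, …, t_r` occur in `Cyc_r`.
* The translation multiplies `∑ h_k z^k` by `1 / (1 - x z)` (`map_shift_hSeries`). Row operations in
  the Jacobi–Trudi determinant then show that `skew r` sends `s_λ` to the sum of the `s_ν` for which
  `λ / ν` is a horizontal strip with `r` cells (`skew_schurPoly`).
* Removing the cells with the largest entry from a tableau gives the same recursion for the number
  of tableaux (`rectKostka_succ`).
-/

open scoped PowerSeries

noncomputable section

namespace LabelCropping

/-! ### Horizontal strips and semistandard tableaux -/

/-- The skew shape `μ / ν` is a horizontal strip: `ν` is contained in `μ`, and every cell of `μ`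
that lies directly below another cell has its upper neighbour in `ν`, so that no column contains
two cells of `μ / ν`. -/
def IsHorizontalStrip (ν μ : YoungDiagram) : Prop :=
  ν ≤ μ ∧ ∀ i j : ℕ, (i + 1, j) ∈ μ → (i, j) ∈ ν

theorem finite_setOf_le (μ : YoungDiagram) : {ν : YoungDiagram | ν ≤ μ}.Finite := by
  refine Set.Finite.of_finite_image (f := YoungDiagram.cells)
    ((μ.cells.powerset.finite_toSet).subset ?_) ?_
  · rintro _ ⟨ν, hν, rfl⟩
    simpa using YoungDiagram.cells_subset_iff.2 hν
  · intro ν _ ν' _ h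
    exact YoungDiagram.ext h

/-- The diagrams `ν` for which `μ / ν` is a horizontal strip with `r` cells. -/
def removals (μ : YoungDiagram) (r : ℕ) : Finset YoungDiagram :=
  ((finite_setOf_le μ).subset
    (show {ν | IsHorizontalStrip ν μ ∧ ν.card + r = μ.card} ⊆ _ from fun _ h => h.1.1)).toFinset

theorem mem_removals {μ ν : YoungDiagram} {r : ℕ} :
    ν ∈ removals μ r ↔ IsHorizontalStrip ν μ ∧ ν.card + r = μ.card := by
  simp [removals]

/-- The tableau `T` has content `0^r 1^r ⋯ (n-1)^r`. This is the condition that defines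
`rectKostka`, whose letters start from `0`. -/
def HasRectContent {μ : YoungDiagram} (r n : ℕ) (T : SemistandardYoungTableau μ) : Prop :=
  ∀ k : ℕ, (μ.cells.filter fun c => T c.1 c.2 = k).card = if k < n then r else 0

theorem HasRectContent.lt {μ : YoungDiagram} {r n : ℕ} {T : SemistandardYoungTableau μ}
    (hT : HasRectContent r n T) {i j : ℕ} (h : (i, j) ∈ μ) : T i j < n := by
  by_contra hlt
  have h0 := hT (T i j)
  rw [if_neg hlt, Finset.card_eq_zero, Finset.filter_eq_empty_iff] at h0
  exact h0 (x := (i, j)) h rfl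

theorem HasRectContent.card_eq {μ : YoungDiagram} {r n : ℕ} {T : SemistandardYoungTableau μ}
    (hT : HasRectContent r n T) : μ.card = r * n := by
  have h := Finset.card_eq_sum_card_fiberwise (s := μ.cells) (t := Finset.range n)
    (f := fun c => T c.1 c.2) fun c hc => by
      simpa using hT.lt (i := c.1) (j := c.2) hc
  have h2 : ∀ k ∈ Finset.range n, (μ.cells.filter fun c => T c.1 c.2 = k).card = r := by
    intro k hk
    rw [hT k, if_pos (Finset.mem_range.1 hk)]
  rw [Finset.sum_congr rfl h2] at h
  rw [YoungDiagram.card, h]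
  simp [mul_comm]

instance finite_hasRectContent (μ : YoungDiagram) (r n : ℕ) :
    Finite {T : SemistandardYoungTableau μ // HasRectContent r n T} := by
  refine Finite.of_injective
    (β := μ.cells → Fin n) (fun T c => ⟨T.1 c.1.1 c.1.2, T.2.lt c.2⟩) ?_
  intro T T' h
  refine Subtype.ext (SemistandardYoungTableau.ext fun i j => ?_)
  by_cases hc : (i, j) ∈ μ
  · simpa using congrFun h ⟨(i, j), hc⟩
  · rw [T.1.zeros hc, T'.1.zeros hc]

/-- The diagram of the cells of `T` with entry less than `n`. -/
def subDiagram {μ : YoungDiagram} (T : SemistandardYoungTableau μ) (n : ℕ) : YoungDiagram where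
  cells := μ.cells.filter fun c => T c.1 c.2 < n
  isLowerSet := by
    rintro ⟨i, j⟩ ⟨i', j'⟩ hle h
    obtain ⟨hi, hj⟩ : i' ≤ i ∧ j' ≤ j := hle
    simp only [Finset.coe_filter, Set.mem_ofPred_eq, YoungDiagram.mem_cells] at h ⊢
    exact ⟨μ.up_left_mem hi hj h.1, ((T.row_weak_of_le hj (μ.up_left_mem hi le_rfl h.1)).trans
      (T.col_weak hi h.1)).trans_lt h.2⟩

theorem mem_subDiagram {μ : YoungDiagram} {T : SemistandardYoungTableau μ} {n : ℕ} {c : ℕ × ℕ} :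
    c ∈ subDiagram T n ↔ c ∈ μ ∧ T c.1 c.2 < n := by
  rw [← YoungDiagram.mem_cells]; simp [subDiagram]

theorem subDiagram_le {μ : YoungDiagram} (T : SemistandardYoungTableau μ) (n : ℕ) :
    subDiagram T n ≤ μ := fun _ hc => (mem_subDiagram.1 hc).1

theorem subDiagram_mem_removals {μ : YoungDiagram} {r n : ℕ} {T : SemistandardYoungTableau μ}
    (hT : HasRectContent r (n + 1) T) : subDiagram T n ∈ removals μ r := by
  refine mem_removals.2 ⟨⟨subDiagram_le T n, fun i j h => mem_subDiagram.2
    ⟨μ.up_left_mem i.le_succ le_rfl h, ?_⟩⟩, ?_⟩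
  · have h1 := T.col_strict (Nat.lt_add_one i) h
    have h2 := hT.lt h
    simp only
    omega
  · have h1 := hT n
    rw [if_pos n.lt_succ_self] at h1
    rw [YoungDiagram.card, YoungDiagram.card, ← h1,
      ← Finset.card_filter_add_card_filter_not (s := μ.cells) (fun c => T c.1 c.2 < n)]
    congr 2
    refine Finset.filter_congr fun c hc => ?_
    have := hT.lt (i := c.1) (j := c.2) hc
    omega

/-- The restriction of a tableau to a smaller shape. -/
def restrictTableau {μ ν : YoungDiagram} (h : ν ≤ μ) (T : SemistandardYoungTableau μ) :
    SemistandardYoungTableau ν where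
  entry i j := if (i, j) ∈ ν then T i j else 0
  row_weak' := by
    intro i j1 j2 hj hc
    rw [if_pos hc, if_pos (ν.up_left_mem le_rfl hj.le hc)]
    exact T.row_weak hj (h hc)
  col_strict' := by
    intro i1 i2 j hi hc
    rw [if_pos hc, if_pos (ν.up_left_mem hi.le le_rfl hc)]
    exact T.col_strict hi (h hc)
  zeros' := fun hc => if_neg hc

theorem restrictTableau_apply {μ ν : YoungDiagram} (h : ν ≤ μ) (T : SemistandardYoungTableau μ)
    {i j : ℕ} (hc : (i, j) ∈ ν) : restrictTableau h T i j = T i j := if_pos hc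

/-- The extension of a tableau with entries below `n` along a horizontal strip, all of whose cells
receive the entry `n`. -/
def extendTableau {μ ν : YoungDiagram} (h : IsHorizontalStrip ν μ) {n : ℕ}
    (T : SemistandardYoungTableau ν) (hT : ∀ i j : ℕ, (i, j) ∈ ν → T i j < n) :
    SemistandardYoungTableau μ where
  entry i j := if (i, j) ∈ ν then T i j else if (i, j) ∈ μ then n else 0
  row_weak' := by
    intro i j1 j2 hj hc
    by_cases h2 : (i, j2) ∈ ν
    · rw [if_pos h2, if_pos (ν.up_left_mem le_rfl hj.le h2)]
      exact T.row_weak hj h2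
    · rw [if_neg h2, if_pos hc]
      by_cases h1 : (i, j1) ∈ ν
      · rw [if_pos h1]; exact (hT _ _ h1).le
      · rw [if_neg h1, if_pos (μ.up_left_mem le_rfl hj.le hc)]
  col_strict' := by
    intro i1 i2 j hi hc
    have h1 : (i1, j) ∈ ν := h.2 i1 j (μ.up_left_mem hi le_rfl hc)
    by_cases h2 : (i2, j) ∈ ν
    · rw [if_pos h2, if_pos h1]
      exact T.col_strict hi h2
    · rw [if_neg h2, if_pos hc, if_pos h1]; exact hT _ _ h1
  zeros' := by
    intro i j hc
    rw [if_neg fun h' => hc (h.1 h'), if_neg hc]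

theorem extendTableau_apply {μ ν : YoungDiagram} (h : IsHorizontalStrip ν μ) {n : ℕ}
    (T : SemistandardYoungTableau ν) (hT : ∀ i j : ℕ, (i, j) ∈ ν → T i j < n) (i j : ℕ) :
    extendTableau h T hT i j = if (i, j) ∈ ν then T i j else if (i, j) ∈ μ then n else 0 := rfl

theorem hasRectContent_restrictTableau {μ : YoungDiagram} {r n : ℕ}
    {T : SemistandardYoungTableau μ} (hT : HasRectContent r (n + 1) T) {ν : YoungDiagram}
    (h : ν ≤ μ) (hν : subDiagram T n = ν) : HasRectContent r n (restrictTableau h T) := by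
  subst hν
  intro k
  have h1 : ((subDiagram T n).cells.filter fun c => restrictTableau h T c.1 c.2 = k)
      = if k < n then μ.cells.filter (fun c => T c.1 c.2 = k) else ∅ := by
    ext c
    simp only [Finset.mem_filter, YoungDiagram.mem_cells]
    constructor
    · rintro ⟨hc, hk⟩
      rw [restrictTableau_apply h T hc] at hk
      rw [mem_subDiagram] at hc
      rw [if_pos (hk ▸ hc.2)]
      simpa using ⟨hc.1, hk⟩
    · intro hc
      split_ifs at hc with hk
      · simp only [Finset.mem_filter, YoungDiagram.mem_cells] at hc
        have hc' : c ∈ subDiagram T n := mem_subDiagram.2 ⟨hc.1, hc.2 ▸ hk⟩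
        exact ⟨hc', by rw [restrictTableau_apply h T hc', hc.2]⟩
      · simp at hc
  rw [h1]
  split_ifs with hk
  · rw [hT k, if_pos (by omega)]
  · rfl

theorem subDiagram_extendTableau {μ ν : YoungDiagram} (h : IsHorizontalStrip ν μ) {n : ℕ}
    (T : SemistandardYoungTableau ν) (hT : ∀ i j : ℕ, (i, j) ∈ ν → T i j < n) :
    subDiagram (extendTableau h T hT) n = ν := by
  refine YoungDiagram.ext (Finset.ext fun c => ?_)
  rw [YoungDiagram.mem_cells, YoungDiagram.mem_cells, mem_subDiagram, extendTableau_apply]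
  by_cases hc : c ∈ ν
  · simp [hc, h.1 hc, hT c.1 c.2 hc]
  · by_cases hc' : c ∈ μ <;> simp [hc, hc']

theorem hasRectContent_extendTableau {μ ν : YoungDiagram} {r n : ℕ} (h : IsHorizontalStrip ν μ)
    (hcard : ν.card + r = μ.card) {T : SemistandardYoungTableau ν} (hT : HasRectContent r n T) :
    HasRectContent r (n + 1) (extendTableau h T fun _ _ => hT.lt) := by
  intro k
  have hsub : ν.cells ⊆ μ.cells := YoungDiagram.cells_subset_iff.2 h.1
  have h1 : (μ.cells.filter fun c => extendTableau h T (fun _ _ => hT.lt) c.1 c.2 = k)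
      = (ν.cells.filter fun c => T c.1 c.2 = k) ∪ if k = n then μ.cells \ ν.cells else ∅ := by
    ext c
    simp only [Finset.mem_filter, extendTableau_apply, Finset.mem_union, YoungDiagram.mem_cells]
    by_cases hc : c ∈ ν
    · have : c ∈ μ := h.1 hc
      split_ifs <;> simp [hc, this]
    · by_cases hc' : c ∈ μ
      · split_ifs with h2
        · simp [hc, hc', h2]
        · simp [hc, hc', Ne.symm h2]
      · split_ifs <;> simp [hc, hc']
  rw [h1, Finset.card_union_of_disjoint, hT k]
  · rcases lt_trichotomy k n with hk | rfl | hk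
    · rw [if_pos hk, if_neg hk.ne, if_pos (by omega)]; simp
    · simp only [lt_irrefl, if_false, if_true, Nat.lt_succ_self]
      rw [Finset.card_sdiff_of_subset hsub]
      simp only [YoungDiagram.card] at hcard
      omega
    · rw [if_neg (by omega), if_neg (by omega), if_neg (by omega)]; simp
  · split_ifs
    · exact Finset.disjoint_of_subset_left (Finset.filter_subset _ _) Finset.disjoint_sdiff
    · simp

/-- The tableaux whose cells with entry less than `n` form the diagram `ν` correspond to the
tableaux of shape `ν`. -/
def subDiagramFiberEquiv {μ ν : YoungDiagram} {r : ℕ} (n : ℕ) (h : ν ∈ removals μ r) :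
    {T : {T : SemistandardYoungTableau μ // HasRectContent r (n + 1) T} //
      subDiagram T.1 n = ν} ≃ {T : SemistandardYoungTableau ν // HasRectContent r n T} where
  toFun T := ⟨restrictTableau (mem_removals.1 h).1.1 T.1.1,
    hasRectContent_restrictTableau T.1.2 _ T.2⟩
  invFun T := ⟨⟨extendTableau (mem_removals.1 h).1 T.1 fun _ _ => T.2.lt,
    hasRectContent_extendTableau (mem_removals.1 h).1 (mem_removals.1 h).2 T.2⟩,
    subDiagram_extendTableau (mem_removals.1 h).1 T.1 fun _ _ => T.2.lt⟩
  left_inv := by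
    rintro ⟨⟨T, hT⟩, hν⟩
    refine Subtype.ext (Subtype.ext (SemistandardYoungTableau.ext fun i j => ?_))
    simp only [extendTableau_apply]
    split_ifs with h1 h2
    · exact restrictTableau_apply _ _ h1
    · have h3 : ¬ T i j < n := fun h3 => h1 (hν ▸ mem_subDiagram.2 ⟨h2, h3⟩)
      have := hT.lt h2
      omega
    · exact (T.zeros h2).symm
  right_inv := by
    rintro ⟨T, hT⟩
    refine Subtype.ext (SemistandardYoungTableau.ext fun i j => ?_)
    by_cases hc : (i, j) ∈ ν
    · simp only
      rw [restrictTableau_apply _ _ hc, extendTableau_apply, if_pos hc]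
    · exact (SemistandardYoungTableau.zeros _ hc).trans (T.zeros hc).symm

/-- The cells of the largest entry form a horizontal strip; removing them gives a recursion for the
number of tableaux. -/
theorem rectKostka_succ (μ : YoungDiagram) (r n : ℕ) :
    rectKostka μ r (n + 1) = ∑ ν ∈ removals μ r, rectKostka ν r n := by
  let f : {T : SemistandardYoungTableau μ // HasRectContent r (n + 1) T} → removals μ r :=
    fun T => ⟨subDiagram T.1 n, subDiagram_mem_removals T.2⟩
  have h1 : rectKostka μ r (n + 1) = Nat.card (Σ ν : removals μ r, {T // f T = ν}) :=
    Nat.card_congr (Equiv.sigmaFiberEquiv f).symm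
  rw [h1, Nat.card_sigma, ← Finset.sum_coe_sort (removals μ r)]
  refine Finset.sum_congr rfl fun ν _ => Nat.card_congr ?_
  exact (Equiv.subtypeEquivRight fun T => by rw [Subtype.ext_iff]).trans
    (subDiagramFiberEquiv n ν.2)

theorem rectKostka_eq_zero {μ : YoungDiagram} {r n : ℕ} (h : μ.card ≠ r * n) :
    rectKostka μ r n = 0 :=
  have : IsEmpty {T : SemistandardYoungTableau μ // HasRectContent r n T} :=
    ⟨fun T => h T.2.card_eq⟩
  Nat.card_of_isEmpty (α := {T : SemistandardYoungTableau μ // HasRectContent r n T})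

theorem rectKostka_bot_zero (r : ℕ) : rectKostka ⊥ r 0 = 1 :=
  have : Unique {T : SemistandardYoungTableau (⊥ : YoungDiagram) // HasRectContent r 0 T} :=
    { default := ⟨default, fun k => by simp⟩
      uniq := fun T => Subtype.ext (SemistandardYoungTableau.ext fun i j => by
        rw [T.1.zeros (YoungDiagram.notMem_bot _),
          SemistandardYoungTableau.zeros _ (YoungDiagram.notMem_bot _)]) }
  Nat.card_unique (α := {T : SemistandardYoungTableau (⊥ : YoungDiagram) // HasRectContent r 0 T})

theorem rectKostka_zero_of_ne_bot {μ : YoungDiagram} (h : μ ≠ ⊥) (r : ℕ) :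
    rectKostka μ r 0 = 0 :=
  rectKostka_eq_zero fun h0 => h (YoungDiagram.ext (by simpa [YoungDiagram.card] using h0))

/-! ### Translation by the power sums of one variable -/

/-- The translation `P(t) ↦ P(t_j + x^j / j)`, with values in polynomials in `x`. In the variables
`t_j = p_j / j` it adjoins the variable `x` to a symmetric function. -/
def shift : TPoly →ₐ[ℂ] Polynomial TPoly :=
  MvPolynomial.aeval fun j : ℕ+ => Polynomial.C (MvPolynomial.X j) +
    Polynomial.C (MvPolynomial.C (1 / ((j : ℕ) : ℂ))) * Polynomial.X ^ (j : ℕ)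

/-- The coefficient of `x^k` in the translated polynomial `P(t_j + x^j / j)`. -/
def skew (k : ℕ) : TPoly →ₗ[ℂ] TPoly :=
  ((Polynomial.lcoeff TPoly k).restrictScalars ℂ).comp shift.toLinearMap

theorem skew_apply (k : ℕ) (P : TPoly) : skew k P = (shift P).coeff k := rfl

theorem shift_X (j : ℕ+) : shift (MvPolynomial.X j) = Polynomial.C (MvPolynomial.X j) +
    Polynomial.C (MvPolynomial.C (1 / ((j : ℕ) : ℂ))) * Polynomial.X ^ (j : ℕ) :=
  MvPolynomial.aeval_X _ _

theorem C_C_one_div_mul_natCast {k : ℕ} (hk : k ≠ 0) :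
    (Polynomial.C (MvPolynomial.C (1 / (k : ℂ))) : Polynomial TPoly) * (k : Polynomial TPoly) =
      1 := by
  have : (k : Polynomial TPoly) = Polynomial.C (MvPolynomial.C (k : ℂ)) := by simp
  rw [this, ← map_mul, ← map_mul, one_div_mul_cancel (Nat.cast_ne_zero.2 hk), map_one, map_one]

theorem tVar_succ (k : ℕ) : tVar (k + 1) = MvPolynomial.X k.succPNat := by
  simp [tVar, Nat.succPNat]

/-- A solution of the differential equation `f' = f g` is determined by its constant term. -/
theorem eq_of_derivative_eq_mul {R : Type*} [CommRing R] [IsAddTorsionFree R] {f₁ f₂ g : R⟦X⟧}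
    (h₁ : PowerSeries.derivative R f₁ = f₁ * g) (h₂ : PowerSeries.derivative R f₂ = f₂ * g)
    (h₀ : PowerSeries.constantCoeff f₁ = PowerSeries.constantCoeff f₂) : f₁ = f₂ := by
  ext n
  induction n using Nat.strong_induction_on with
  | _ n ih =>
    cases n with
    | zero => simpa using h₀
    | succ n =>
      have e₁ := congrArg (PowerSeries.coeff n) h₁
      have e₂ := congrArg (PowerSeries.coeff n) h₂
      rw [PowerSeries.coeff_derivative, PowerSeries.coeff_mul] at e₁ e₂
      have h : PowerSeries.coeff (n + 1) f₁ * (n + 1) = PowerSeries.coeff (n + 1) f₂ * (n + 1) := by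
        rw [e₁, e₂]
        refine Finset.sum_congr rfl fun p hp => ?_
        rw [ih p.1 (by have := Finset.HasAntidiagonal.mem_antidiagonal.1 hp; omega)]
      rw [← Nat.cast_succ, mul_comm, ← nsmul_eq_mul, mul_comm, ← nsmul_eq_mul] at h
      exact (smul_right_inj n.succ_ne_zero).mp h

theorem derivative_map {R S : Type*} [CommRing R] [CommRing S] (φ : R →+* S) (f : R⟦X⟧) :
    PowerSeries.derivative S (PowerSeries.map φ f) =
      PowerSeries.map φ (PowerSeries.derivative R f) := by
  ext n
  simp [PowerSeries.coeff_derivative]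

theorem derivative_one_sub_C_mul_X_mul {R : Type*} [CommRing R] (x : R) (f : R⟦X⟧) :
    PowerSeries.derivative R ((1 - PowerSeries.C x * PowerSeries.X) * f) =
      (1 - PowerSeries.C x * PowerSeries.X) * PowerSeries.derivative R f -
        PowerSeries.C x * f := by
  simp only [map_sub, Derivation.leibniz, smul_eq_mul, PowerSeries.derivative_C,
    PowerSeries.derivative_X, PowerSeries.derivative_one]
  ring

/-- The generating series `∑ h_k z^k`. -/
def hSeries : TPoly⟦X⟧ := (PowerSeries.exp TPoly).subst tSeries

theorem coeff_hSeries (k : ℕ) : PowerSeries.coeff k hSeries = hPoly k := rfl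

theorem derivative_hSeries : PowerSeries.derivative TPoly hSeries =
    hSeries * PowerSeries.derivative TPoly tSeries := by
  rw [hSeries, PowerSeries.derivative_subst hasSubst_tSeries, PowerSeries.derivative_exp]

theorem constantCoeff_tSeries : PowerSeries.constantCoeff tSeries = 0 := by
  rw [← PowerSeries.coeff_zero_eq_constantCoeff_apply]; simp [tSeries, tVar]

theorem constantCoeff_hSeries : PowerSeries.constantCoeff hSeries = 1 := by
  have h := PowerSeries.constantCoeff_subst hasSubst_tSeries (PowerSeries.exp TPoly)
  have h' : PowerSeries.constantCoeff hSeries = _ := h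
  rw [h', finsum_eq_single _ 0]
  · simp
  · intro d hd
    have : MvPowerSeries.constantCoeff (tSeries ^ d) = 0 := by
      have := congrArg (· ^ d) constantCoeff_tSeries
      simp only [zero_pow hd] at this
      rw [map_pow]
      exact this
    rw [this, smul_zero]

theorem hPoly_zero : hPoly 0 = 1 := by
  rw [← coeff_hSeries, PowerSeries.coeff_zero_eq_constantCoeff_apply, constantCoeff_hSeries]

/-- The translation adds `∑_j x^j z^j / j` to `∑_j t_j z^j`; differentiation in `z` removes the
denominators. -/
theorem derivative_map_shift_tSeries :
    PowerSeries.derivative _ (PowerSeries.map (shift : TPoly →+* Polynomial TPoly) tSeries) =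
      PowerSeries.map Polynomial.C (PowerSeries.derivative TPoly tSeries) +
        PowerSeries.mk fun k => Polynomial.X ^ (k + 1) := by
  ext1 k
  rw [PowerSeries.coeff_derivative, map_add, PowerSeries.coeff_mk, PowerSeries.coeff_map,
    PowerSeries.coeff_map, PowerSeries.coeff_derivative, tSeries, PowerSeries.coeff_mk, tVar_succ]
  have h2 := C_C_one_div_mul_natCast k.succ_ne_zero
  have h3 := shift_X k.succPNat
  simp only [RingHom.coe_coe, h3, Nat.succPNat_coe, Nat.succ_eq_add_one, Nat.cast_succ, map_mul,
    map_add, map_natCast, map_one] at h2 ⊢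
  linear_combination Polynomial.X ^ (k + 1) * h2

/-- Adjoining a variable multiplies `∑ h_k z^k` by `1 / (1 - x z)`. -/
theorem map_shift_hSeries :
    (1 - PowerSeries.C (Polynomial.X : Polynomial TPoly) * PowerSeries.X) *
      PowerSeries.map (shift : TPoly →+* Polynomial TPoly) hSeries =
        PowerSeries.map Polynomial.C hSeries := by
  have hgeom : (1 - PowerSeries.C (Polynomial.X : Polynomial TPoly) * PowerSeries.X) *
      (PowerSeries.mk fun k => Polynomial.X ^ (k + 1)) = PowerSeries.C Polynomial.X := by
    ext1 k
    rw [sub_mul, one_mul, mul_assoc, map_sub, PowerSeries.coeff_mk, PowerSeries.coeff_C_mul,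
      PowerSeries.coeff_C]
    cases k with
    | zero => simp
    | succ k => rw [PowerSeries.coeff_succ_X_mul, PowerSeries.coeff_mk]; simp [pow_succ']
  refine eq_of_derivative_eq_mul
    (g := PowerSeries.map Polynomial.C (PowerSeries.derivative TPoly tSeries)) ?_ ?_ ?_
  · rw [derivative_one_sub_C_mul_X_mul, derivative_map, derivative_hSeries, map_mul,
      ← derivative_map, derivative_map_shift_tSeries]
    linear_combination PowerSeries.map (shift : TPoly →+* Polynomial TPoly) hSeries * hgeom
  · rw [derivative_map, derivative_hSeries, map_mul]
  · have h : ∀ {S : Type} [CommRing S] (φ : TPoly →+* S),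
        PowerSeries.constantCoeff (PowerSeries.map φ hSeries) = 1 := by
      intro S _ φ
      rw [← PowerSeries.coeff_zero_eq_constantCoeff_apply, PowerSeries.coeff_map, coeff_hSeries,
        hPoly_zero, map_one]
    rw [map_mul, h, h]
    simp

theorem shift_hPoly_succ (k : ℕ) :
    shift (hPoly (k + 1)) = Polynomial.C (hPoly (k + 1)) + Polynomial.X * shift (hPoly k) := by
  have h := congrArg (PowerSeries.coeff (k + 1)) map_shift_hSeries
  rw [sub_mul, one_mul, mul_assoc, map_sub, PowerSeries.coeff_C_mul,
    PowerSeries.coeff_succ_X_mul] at h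
  simp only [PowerSeries.coeff_map, coeff_hSeries, RingHom.coe_coe] at h
  rw [← h]; ring

theorem hPolyInt_of_neg {k : ℤ} (hk : k < 0) : hPolyInt k = 0 := if_neg hk.not_ge

theorem hPolyInt_natCast (k : ℕ) : hPolyInt k = hPoly k := by simp [hPolyInt]

theorem shift_hPolyInt (k : ℤ) :
    shift (hPolyInt k) = Polynomial.C (hPolyInt k) + Polynomial.X * shift (hPolyInt (k - 1)) := by
  rcases lt_or_ge k 0 with hk | hk
  · rw [hPolyInt_of_neg hk, hPolyInt_of_neg (by omega)]; simp
  · obtain ⟨k, rfl⟩ := Int.eq_ofNat_of_zero_le hk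
    cases k with
    | zero =>
      rw [hPolyInt_of_neg (k := ((0 : ℕ) : ℤ) - 1) (by simp), hPolyInt_natCast, hPoly_zero]; simp
    | succ k =>
      have : (((k + 1 : ℕ) : ℤ) - 1) = (k : ℤ) := by push_cast; ring
      rw [this, hPolyInt_natCast, hPolyInt_natCast, shift_hPoly_succ]

/-! ### The branching rule for Jacobi–Trudi determinants -/

/-- The recursion `H(k) = h(k) + x H(k - 1)`, iterated from `a` down to `b`. -/
theorem eq_sum_Icc_add_of_recursion {R : Type*} [CommRing R] {h H : ℤ → R} {x : R}
    (hH : ∀ k, H k = h k + x * H (k - 1)) {b a : ℕ} (hab : b ≤ a) (c : ℤ) :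
    H (a + c) = ∑ m ∈ Finset.Icc b a, x ^ (a - m) * h (m + c) +
      x ^ (a - b + 1) * H (b - 1 + c) := by
  induction a, hab using Nat.le_induction with
  | base =>
    rw [hH]
    simp only [Finset.Icc_self, Finset.sum_singleton, Nat.sub_self, pow_zero, one_mul, zero_add,
      pow_one]
    congr 3; ring
  | succ a hab ih =>
    rw [hH, show ((a + 1 : ℕ) : ℤ) + c - 1 = a + c by push_cast; ring, ih,
      ← Finset.insert_Icc_right_eq_Icc_add_one (by omega), Finset.sum_insert (by simp),
      mul_add, Finset.mul_sum]
    have h1 : ∀ m ∈ Finset.Icc b a, x * (x ^ (a - m) * h (m + c)) =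
        x ^ (a + 1 - m) * h (m + c) := by
      intro m hm
      rw [show a + 1 - m = (a - m) + 1 by have := (Finset.mem_Icc.1 hm).2; omega]; ring
    rw [Finset.sum_congr rfl h1, show a + 1 - b + 1 = (a - b + 1) + 1 by omega]
    simp only [Nat.sub_self]
    ring

/-- If `∑ H(k) z^k = (1 - x z)⁻¹ ∑ h(k) z^k`, the Jacobi–Trudi determinant of `H` for the row
lengths `f` is the sum of those of `h` over the row lengths that interlace `f`. Subtracting from
each row a multiple of the next one leaves in row `i` a sum over `f (i + 1) ≤ m ≤ f i`. -/
theorem det_eq_sum_interlacing {R : Type*} [CommRing R] {h H : ℤ → R} {x : R}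
    (hH : ∀ k, H k = h k + x * H (k - 1)) (hneg : ∀ k < 0, H k = 0) (N : ℕ) {f : ℕ → ℕ}
    (hf : Antitone f) (hN : f N = 0) :
    (Matrix.of fun i j : Fin N => H ((f i : ℤ) - (i : ℤ) + (j : ℤ))).det =
      ∑ g ∈ Fintype.piFinset fun i : Fin N => Finset.Icc (f (i + 1)) (f i),
        x ^ (∑ i : Fin N, (f i - g i)) *
          (Matrix.of fun i j : Fin N => h ((g i : ℤ) - (i : ℤ) + (j : ℤ))).det := by
  have hB : (Matrix.of fun i j : Fin N => H ((f i : ℤ) - (i : ℤ) + (j : ℤ))).det =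
      (Matrix.of fun i j : Fin N => ∑ m ∈ Finset.Icc (f (i + 1)) (f i),
        x ^ (f i - m) * h ((m : ℤ) - (i : ℤ) + (j : ℤ))).det := by
    cases N with
    | zero => simp
    | succ n =>
      have key : ∀ i j : Fin (n + 1), H ((f i : ℤ) - (i : ℤ) + (j : ℤ)) =
          ∑ m ∈ Finset.Icc (f (i + 1)) (f i), x ^ (f i - m) * h ((m : ℤ) - (i : ℤ) + (j : ℤ)) +
            x ^ (f i - f (i + 1) + 1) * H ((f (i + 1) : ℤ) - ((i : ℤ) + 1) + (j : ℤ)) := by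
        intro i j
        have := eq_sum_Icc_add_of_recursion hH (hf (Nat.le_succ (i : ℕ))) (-(i : ℤ) + j)
        simp only [← add_assoc, ← sub_eq_add_neg] at this
        rw [this, Nat.succ_eq_add_one, show (f ((i : ℕ) + 1) : ℤ) - 1 - (i : ℤ) + (j : ℤ) =
          (f ((i : ℕ) + 1) : ℤ) - ((i : ℤ) + 1) + (j : ℤ) by ring]
      -- Reversing the order of the indices turns the next row into the previous one.
      rw [← Matrix.det_submatrix_equiv_self Fin.revPerm, ← Matrix.det_submatrix_equiv_self
        Fin.revPerm (Matrix.of fun i j : Fin (n + 1) => ∑ m ∈ Finset.Icc (f (i + 1)) (f i),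
          x ^ (f i - m) * h ((m : ℤ) - (i : ℤ) + (j : ℤ)))]
      refine Matrix.det_eq_of_forall_row_eq_smul_add_pred
        (fun i => x ^ (f (n - 1 - i) - f (n - 1 - i + 1) + 1)) (fun j => ?_) fun i j => ?_
      · simp only [Matrix.submatrix_apply, Matrix.of_apply, Fin.revPerm_apply]
        rw [key, hneg, mul_zero, add_zero]
        have h1 := Fin.val_rev j
        have h2 : ((Fin.rev (0 : Fin (n + 1))) : ℕ) = n := by simp
        rw [h2, hN]
        omega
      · simp only [Matrix.submatrix_apply, Matrix.of_apply, Fin.revPerm_apply]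
        rw [key]
        have h1 : ((Fin.rev i.succ : Fin (n + 1)) : ℕ) = n - 1 - i := by
          simp [Fin.val_rev]; omega
        have h2 : ((Fin.rev i.castSucc : Fin (n + 1)) : ℕ) = n - 1 - i + 1 := by
          simp [Fin.val_rev]; omega
        rw [h2, h1]
        push_cast
        rfl
  rw [hB]
  have hsum := (Matrix.detRowAlternating (R := R) (n := Fin N)).toMultilinearMap.map_sum_finset
    (fun (i : Fin N) (m : ℕ) (j : Fin N) => x ^ (f i - m) * h ((m : ℤ) - (i : ℤ) + (j : ℤ)))
    (fun i : Fin N => Finset.Icc (f (i + 1)) (f i))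
  have hrow : (Matrix.of fun i j : Fin N => ∑ m ∈ Finset.Icc (f (i + 1)) (f i),
      x ^ (f i - m) * h ((m : ℤ) - (i : ℤ) + (j : ℤ))) =
      fun i : Fin N => ∑ m ∈ Finset.Icc (f (i + 1)) (f i), fun j : Fin N =>
        x ^ (f i - m) * h ((m : ℤ) - (i : ℤ) + (j : ℤ)) := by
    ext i j
    simp [Finset.sum_apply]
  rw [hrow]
  refine hsum.trans (Finset.sum_congr rfl fun g _ => ?_)
  rw [← Finset.prod_pow_eq_pow_sum, ← Matrix.det_mul_column]
  rfl

/-- The Jacobi–Trudi determinant of size `N` for the row lengths `f`. -/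
def schurDet (N : ℕ) (f : ℕ → ℕ) : TPoly :=
  (Matrix.of fun i j : Fin N => hPolyInt ((f i : ℤ) - (i : ℤ) + (j : ℤ))).det

/-- A last row of length `0` does not change the determinant, since the last row of the matrix is
then `(0, …, 0, 1)`. -/
theorem schurDet_succ {N : ℕ} {f : ℕ → ℕ} (hN : f N = 0) :
    schurDet (N + 1) f = schurDet N f := by
  rw [schurDet, Matrix.det_succ_row _ (Fin.last N), Finset.sum_eq_single (Fin.last N)]
  · simp only [Matrix.of_apply, Fin.val_last, hN]
    rw [show ((0 : ℕ) : ℤ) - N + N = ((0 : ℕ) : ℤ) by simp, hPolyInt_natCast, hPoly_zero,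
      ← two_mul, pow_mul, neg_one_sq, one_pow, one_mul, one_mul, Fin.succAbove_last]
    rfl
  · intro j _ hj
    have hj' : (j : ℕ) < N := by
      have := Fin.val_ne_of_ne hj
      have := j.isLt
      simp at *
      omega
    simp only [Matrix.of_apply, Fin.val_last, hN]
    rw [hPolyInt_of_neg (by omega), mul_zero, zero_mul]
  · simp

theorem rowLen_eq_zero {μ : YoungDiagram} {i : ℕ} (h : μ.colLen 0 ≤ i) : μ.rowLen i = 0 := by
  by_contra h0
  have h1 : (i, 0) ∈ μ := YoungDiagram.mem_iff_lt_rowLen.2 (Nat.pos_of_ne_zero h0)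
  exact absurd (YoungDiagram.mem_iff_lt_colLen.1 h1) h.not_gt

theorem schurPoly_eq_schurDet {μ : YoungDiagram} {N : ℕ} (h : μ.colLen 0 ≤ N) :
    schurPoly μ = schurDet N μ.rowLen := by
  induction N, h using Nat.le_induction with
  | base => rfl
  | succ N h ih => rw [ih, schurDet_succ (rowLen_eq_zero h)]

theorem card_eq_sum_rowLen {μ : YoungDiagram} {N : ℕ} (h : μ.colLen 0 ≤ N) :
    μ.card = ∑ i : Fin N, μ.rowLen i := by
  rw [Fin.sum_univ_eq_sum_range (fun i => μ.rowLen i), YoungDiagram.card,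
    Finset.card_eq_sum_card_fiberwise (t := Finset.range N) (f := Prod.fst)]
  · exact Finset.sum_congr rfl fun i _ => (YoungDiagram.rowLen_eq_card μ).symm
  · rintro ⟨i, j⟩ hc
    have h0 : (i, 0) ∈ μ := μ.up_left_mem le_rfl (Nat.zero_le j) hc
    simpa using (YoungDiagram.mem_iff_lt_colLen.1 h0).trans_le h

theorem le_iff_rowLen_le {μ ν : YoungDiagram} : ν ≤ μ ↔ ∀ i, ν.rowLen i ≤ μ.rowLen i := by
  constructor
  · intro h i
    by_contra! hlt
    have h1 : (i, μ.rowLen i) ∈ μ := h (YoungDiagram.mem_iff_lt_rowLen.2 hlt)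
    exact lt_irrefl _ (YoungDiagram.mem_iff_lt_rowLen.1 h1)
  · rintro h ⟨i, j⟩ hc
    exact YoungDiagram.mem_iff_lt_rowLen.2
      ((YoungDiagram.mem_iff_lt_rowLen.1 hc).trans_le (h i))

theorem eq_of_rowLen_eq {μ ν : YoungDiagram} (h : ∀ i, ν.rowLen i = μ.rowLen i) : ν = μ :=
  le_antisymm (le_iff_rowLen_le.2 fun i => (h i).le) (le_iff_rowLen_le.2 fun i => (h i).ge)

theorem isHorizontalStrip_iff {μ ν : YoungDiagram} : IsHorizontalStrip ν μ ↔
    ∀ i, μ.rowLen (i + 1) ≤ ν.rowLen i ∧ ν.rowLen i ≤ μ.rowLen i := by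
  rw [IsHorizontalStrip, le_iff_rowLen_le, forall_and, and_comm]
  refine and_congr_left fun _ => forall_congr' fun i => ?_
  simp only [YoungDiagram.mem_iff_lt_rowLen]
  constructor
  · intro h
    by_contra! hlt
    exact lt_irrefl _ (h _ hlt)
  · exact fun h j hj => hj.trans_le h

theorem colLen_le_of_le {μ ν : YoungDiagram} (h : ν ≤ μ) : ν.colLen 0 ≤ μ.colLen 0 := by
  by_contra! hlt
  have h1 : (μ.colLen 0, 0) ∈ μ := h (YoungDiagram.mem_iff_lt_colLen.2 hlt)
  exact lt_irrefl _ (YoungDiagram.mem_iff_lt_colLen.1 h1)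

/-- An antitone sequence bounded by the row lengths of a diagram is the sequence of row lengths of a
smaller diagram. -/
theorem exists_rowLen_eq (μ : YoungDiagram) {g : ℕ → ℕ} (hg : Antitone g)
    (hle : ∀ i, g i ≤ μ.rowLen i) : ∃ ν : YoungDiagram, ∀ i, ν.rowLen i = g i := by
  let ν : YoungDiagram :=
    { cells := μ.cells.filter fun c => c.2 < g c.1
      isLowerSet := by
        rintro ⟨i, j⟩ ⟨i', j'⟩ hle h
        obtain ⟨hi, hj⟩ : i' ≤ i ∧ j' ≤ j := hle
        simp only [Finset.coe_filter, Set.mem_ofPred_eq, YoungDiagram.mem_cells] at h ⊢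
        exact ⟨μ.up_left_mem hi hj h.1, (hj.trans_lt h.2).trans_le (hg hi)⟩ }
  have hν : ∀ i j, j < ν.rowLen i ↔ j < g i := by
    intro i j
    rw [← YoungDiagram.mem_iff_lt_rowLen, ← YoungDiagram.mem_cells]
    simp only [ν, Finset.mem_filter, YoungDiagram.mem_cells, YoungDiagram.mem_iff_lt_rowLen]
    exact and_iff_right_of_imp fun h => h.trans_le (hle i)
  exact ⟨ν, fun i => eq_of_forall_lt_iff (hν i)⟩

/-- Adjoining a variable to a Schur polynomial removes horizontal strips. -/
theorem skew_schurPoly (r : ℕ) (μ : YoungDiagram) :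
    skew r (schurPoly μ) = ∑ ν ∈ removals μ r, schurPoly ν := by
  have hzero : ∀ i, μ.colLen 0 ≤ i → μ.rowLen i = 0 := fun i => rowLen_eq_zero
  have hshift : shift (schurPoly μ) = (Matrix.of fun i j : Fin (μ.colLen 0) =>
      shift (hPolyInt ((μ.rowLen i : ℤ) - (i : ℤ) + (j : ℤ)))).det := by
    rw [schurPoly, AlgHom.map_det]
    rfl
  have hC : ∀ g : Fin (μ.colLen 0) → ℕ, (Matrix.of fun i j : Fin (μ.colLen 0) =>
      Polynomial.C (hPolyInt ((g i : ℤ) - (i : ℤ) + (j : ℤ)))).det =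
      Polynomial.C (Matrix.of fun i j : Fin (μ.colLen 0) =>
        hPolyInt ((g i : ℤ) - (i : ℤ) + (j : ℤ))).det := by
    intro g
    rw [RingHom.map_det]
    rfl
  rw [skew_apply, hshift, det_eq_sum_interlacing (h := fun k => Polynomial.C (hPolyInt k))
    (H := fun k => shift (hPolyInt k)) shift_hPolyInt
    (fun k hk => by rw [hPolyInt_of_neg hk, map_zero]) _ (f := μ.rowLen)
    (fun i j h => μ.rowLen_anti i j h) (rowLen_eq_zero le_rfl)]
  simp only [hC, Polynomial.finsetSum_coeff, Polynomial.coeff_X_pow_mul', Polynomial.coeff_C]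
  have hite : ∀ (e : ℕ) (d : TPoly),
      (if e ≤ r then if r - e = 0 then d else 0 else 0) = if e = r then d else 0 := by
    intro e d
    split_ifs <;> first | rfl | omega
  simp only [hite]
  rw [← Finset.sum_filter]
  symm
  refine Finset.sum_nbij (fun ν i => ν.rowLen i) ?_ ?_ ?_ ?_
  · intro ν hν
    obtain ⟨hs, hcard⟩ := mem_removals.1 hν
    have hs' := isHorizontalStrip_iff.1 hs
    refine Finset.mem_filter.2 ⟨Fintype.mem_piFinset.2 fun i => Finset.mem_Icc.2 (hs' i), ?_⟩
    rw [card_eq_sum_rowLen (colLen_le_of_le hs.1),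
      card_eq_sum_rowLen (le_refl (μ.colLen 0))] at hcard
    rw [Finset.sum_tsub_distrib (Finset.univ : Finset (Fin (μ.colLen 0)))
      (f := fun i => μ.rowLen i) (g := fun i => ν.rowLen i) fun i _ => (hs' i).2]
    omega
  · intro ν hν ν' hν' h
    have hs := isHorizontalStrip_iff.1 (mem_removals.1 hν).1
    have hs' := isHorizontalStrip_iff.1 (mem_removals.1 hν').1
    refine eq_of_rowLen_eq fun i => ?_
    rcases lt_or_ge i (μ.colLen 0) with hi | hi
    · exact congrFun h ⟨i, hi⟩
    · have h1 := hs i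
      have h2 := hs' i
      have h3 := hzero i hi
      omega
  · intro g hg
    obtain ⟨hg1, hg2⟩ := Finset.mem_filter.1 hg
    have hg3 := fun i => Finset.mem_Icc.1 (Fintype.mem_piFinset.1 hg1 i)
    let g' : ℕ → ℕ := fun i => if h : i < μ.colLen 0 then g ⟨i, h⟩ else 0
    have hg' : ∀ i : Fin (μ.colLen 0), g' i = g i := fun i => dif_pos i.isLt
    have hint : ∀ i, μ.rowLen (i + 1) ≤ g' i ∧ g' i ≤ μ.rowLen i := by
      intro i
      rcases lt_or_ge i (μ.colLen 0) with hi | hi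
      · simpa only [hg' ⟨i, hi⟩] using hg3 ⟨i, hi⟩
      · rw [hzero _ hi, hzero _ (hi.trans i.le_succ)]
        simp [g', hi.not_gt]
    obtain ⟨ν, hν⟩ := exists_rowLen_eq μ (g := g')
      (antitone_nat_of_succ_le fun i => (hint (i + 1)).2.trans (hint i).1) fun i => (hint i).2
    have hs : IsHorizontalStrip ν μ := isHorizontalStrip_iff.2 fun i => by
      rw [hν]; exact hint i
    refine ⟨ν, mem_removals.2 ⟨hs, ?_⟩, funext fun i => (hν i).trans (hg' i)⟩
    rw [card_eq_sum_rowLen (colLen_le_of_le hs.1), card_eq_sum_rowLen (le_refl (μ.colLen 0)), ← hg2,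
      ← Finset.sum_add_distrib]
    refine Finset.sum_congr rfl fun i _ => ?_
    rw [hν, hg']
    have := (hg3 i).2
    omega
  · intro ν hν
    exact schurPoly_eq_schurDet (colLen_le_of_le (mem_removals.1 hν).1.1)

theorem constantCoeff_hPoly_succ (k : ℕ) : MvPolynomial.constantCoeff (hPoly (k + 1)) = 0 := by
  have ht : PowerSeries.map (MvPolynomial.constantCoeff : TPoly →+* ℂ)
      (PowerSeries.derivative TPoly tSeries) = 0 := by
    ext k
    simp [PowerSeries.coeff_derivative, tSeries, tVar_succ]
  have h := congrArg (fun f => PowerSeries.coeff k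
    (PowerSeries.map (MvPolynomial.constantCoeff : TPoly →+* ℂ) f)) derivative_hSeries
  simp only [map_mul, ht, mul_zero, map_zero] at h
  rw [PowerSeries.coeff_map, PowerSeries.coeff_derivative, coeff_hSeries, map_mul] at h
  refine (mul_eq_zero.1 h).resolve_right ?_
  simpa using k.cast_add_one_ne_zero

theorem schurPoly_bot : schurPoly ⊥ = 1 := by
  have h : (⊥ : YoungDiagram).colLen 0 ≤ 0 := by
    by_contra! h
    exact YoungDiagram.notMem_bot _ (YoungDiagram.mem_iff_lt_colLen.2 h)
  rw [schurPoly_eq_schurDet h, schurDet, Matrix.det_fin_zero]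

theorem constantCoeff_schurPoly {μ : YoungDiagram} (h : μ ≠ ⊥) :
    MvPolynomial.constantCoeff (schurPoly μ) = 0 := by
  have h0 : (0, 0) ∈ μ := by
    by_contra h0
    refine h (YoungDiagram.ext (Finset.eq_empty_of_forall_notMem fun c hc => h0 ?_))
    exact μ.up_left_mem (Nat.zero_le c.1) (Nat.zero_le c.2) hc
  have hrow := YoungDiagram.mem_iff_lt_rowLen.1 h0
  have hcol := YoungDiagram.mem_iff_lt_colLen.1 h0
  rw [schurPoly, RingHom.map_det]
  refine Matrix.det_eq_zero_of_row_eq_zero (⟨0, hcol⟩ : Fin (μ.colLen 0)) fun j => ?_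
  simp only [RingHom.mapMatrix_apply, Matrix.map_apply, Matrix.of_apply]
  obtain ⟨k, hk⟩ : ∃ k : ℕ, μ.rowLen 0 + j = k + 1 :=
    Nat.exists_eq_succ_of_ne_zero (by omega)
  rw [show (μ.rowLen 0 : ℤ) - ((0 : ℕ) : ℤ) + (j : ℤ) = ((k + 1 : ℕ) : ℤ) by rw [← hk]; simp,
    hPolyInt_natCast, constantCoeff_hPoly_succ]

/-- Removing `n` horizontal strips with `r` cells each from `μ` and ending with the empty diagram is
the same as filling `μ` with a tableau of content `0^r ⋯ (n-1)^r`. -/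
theorem constantCoeff_iterate_skew_schurPoly (r n : ℕ) (μ : YoungDiagram) :
    MvPolynomial.constantCoeff ((skew r)^[n] (schurPoly μ)) = (rectKostka μ r n : ℂ) := by
  induction n generalizing μ with
  | zero =>
    by_cases h : μ = ⊥
    · subst h; simp [schurPoly_bot, rectKostka_bot_zero]
    · simp [constantCoeff_schurPoly h, rectKostka_zero_of_ne_bot h]
  | succ n ih =>
    rw [Function.iterate_succ_apply, skew_schurPoly, ← Module.End.coe_pow, map_sum, map_sum,
      rectKostka_succ, Nat.cast_sum]
    refine Finset.sum_congr rfl fun ν _ => ?_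
    rw [Module.End.coe_pow, ih]

/-! ### Recursions for the cycle index and for the skewing operators -/

/-- The order `z = ∏ n^{m_n} m_n!` of the centralizer of a permutation whose cycle type `s` has
`m_n` parts equal to `n`. -/
def centralizerOrder (s : Multiset ℕ) : ℕ :=
  s.prod * ∏ n ∈ s.toFinset, (s.count n).factorial

theorem prod_factorial_count_of_subset {s : Multiset ℕ} {F : Finset ℕ} (h : s.toFinset ⊆ F) :
    ∏ n ∈ s.toFinset, (s.count n).factorial = ∏ n ∈ F, (s.count n).factorial := by
  refine Finset.prod_subset h fun n _ hn => ?_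
  rw [Multiset.count_eq_zero_of_notMem (by simpa using hn), Nat.factorial_zero]

theorem centralizerOrder_cons (a : ℕ) (s : Multiset ℕ) :
    centralizerOrder (a ::ₘ s) = a * (s.count a + 1) * centralizerOrder s := by
  have h1 : s.toFinset ⊆ insert a s.toFinset := Finset.subset_insert _ _
  have h2 : (a ::ₘ s).toFinset ⊆ insert a s.toFinset := by rw [Multiset.toFinset_cons]
  have ha : a ∈ insert a s.toFinset := Finset.mem_insert_self _ _
  rw [centralizerOrder, centralizerOrder, prod_factorial_count_of_subset h1,
    prod_factorial_count_of_subset h2, ← Finset.mul_prod_erase _ _ ha,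
    ← Finset.mul_prod_erase _ (fun n => (s.count n).factorial) ha, Multiset.prod_cons,
    Multiset.count_cons_self, Nat.factorial_succ]
  have h3 : ∀ n ∈ (insert a s.toFinset).erase a,
      ((a ::ₘ s).count n).factorial = (s.count n).factorial := fun n hn => by
    rw [Multiset.count_cons_of_ne (Finset.ne_of_mem_erase hn)]
  rw [Finset.prod_congr rfl h3]
  ring

theorem centralizerOrder_ne_zero {s : Multiset ℕ} (h : 0 ∉ s) : centralizerOrder s ≠ 0 :=
  mul_ne_zero (Multiset.prod_ne_zero h)
    (Finset.prod_ne_zero_iff.2 fun _ _ => Nat.factorial_ne_zero _)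

theorem Partition.zero_notMem {k : ℕ} (μ : k.Partition) : 0 ∉ μ.parts :=
  fun h => (μ.parts_pos h).ne' rfl

theorem filter_two_le_add_replicate {s : Multiset ℕ} (h : 0 ∉ s) :
    s.filter (2 ≤ ·) + Multiset.replicate (s.count 1) 1 = s := by
  rw [← Multiset.filter_eq', ← Multiset.filter_add_not (2 ≤ ·) s]
  congr 1
  · rw [Multiset.filter_add_not]
  · rw [Multiset.filter_add_not]
    refine Multiset.filter_congr fun n hn => ?_
    have : n ≠ 0 := fun h0 => h (h0 ▸ hn)
    omega

/-- The orbit-stabilizer formula `|C_μ| z_μ = k!`. The multiset `m` of parts at least `2` is the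
cycle type in the sense of `Equiv.Perm.cycleType`, which omits the `c` fixed points. -/
theorem conjClassCard_mul_centralizerOrder {k : ℕ} (μ : k.Partition) :
    conjClassCard μ * centralizerOrder μ.parts = k.factorial := by
  set m := μ.parts.filter (2 ≤ ·) with hm
  set c := μ.parts.count 1
  have hsplit : m + Multiset.replicate c 1 = μ.parts :=
    filter_two_le_add_replicate (Partition.zero_notMem μ)
  have hsum : m.sum + c = k := by
    have := congrArg Multiset.sum hsplit
    rw [Multiset.sum_add, Multiset.sum_replicate, μ.parts_sum] at this
    simpa using this
  have hprod : μ.parts.prod = m.prod := by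
    rw [← hsplit, Multiset.prod_add, Multiset.prod_replicate, one_pow, mul_one]
  have hfact : ∏ n ∈ μ.parts.toFinset, (μ.parts.count n).factorial =
      c.factorial * ∏ n ∈ m.toFinset, (m.count n).factorial := by
    have h1 : μ.parts.toFinset ⊆ insert 1 m.toFinset := by
      intro n hn
      have h0 : n ≠ 0 := fun h0 => Partition.zero_notMem μ (h0 ▸ Multiset.mem_toFinset.1 hn)
      simp only [Finset.mem_insert, Multiset.mem_toFinset, hm, Multiset.mem_filter]
      by_cases h : n = 1
      · exact Or.inl h
      · exact Or.inr ⟨Multiset.mem_toFinset.1 hn, by omega⟩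
    rw [prod_factorial_count_of_subset h1, Finset.prod_insert (by simp [hm])]
    congr 1
    refine Finset.prod_congr rfl fun n hn => ?_
    rw [hm, Multiset.count_filter_of_pos (by simpa [hm] using (Multiset.mem_filter.1
      (Multiset.mem_toFinset.1 hn)).2)]
  have hcard : conjClassCard μ =
      (Finset.univ.filter fun σ : Equiv.Perm (Fin k) => σ.cycleType = m).card := by
    rw [conjClassCard, Nat.card_eq_fintype_card, Fintype.card_subtype]
    congr 1
    refine Finset.filter_congr fun σ _ => ?_
    constructor
    · intro h
      rw [← Equiv.Perm.filter_parts_partition_eq_cycleType, h]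
    · intro h
      have h1 := filter_two_le_add_replicate (Partition.zero_notMem σ.partition)
      have h2 := congrArg Multiset.sum h1
      rw [Equiv.Perm.filter_parts_partition_eq_cycleType, h] at h1 h2
      rw [Multiset.sum_add, Multiset.sum_replicate, σ.partition.parts_sum, smul_eq_mul,
        mul_one] at h2
      have h3 := Fintype.card_fin k
      rw [← h1, ← hsplit, show σ.partition.parts.count 1 = c by omega]
  have h := Equiv.Perm.card_of_cycleType_mul_eq (Fin k) m
  rw [Fintype.card_fin, if_pos ⟨by omega, fun a ha => (Multiset.mem_filter.1 ha).2⟩,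
    show k - m.sum = c by omega] at h
  rw [hcard, centralizerOrder, hprod, hfact, ← h]
  ring

theorem cycPoly_eq_sum (k : ℕ) : cycPoly k = ∑ μ : k.Partition,
    MvPolynomial.C (1 / (centralizerOrder μ.parts : ℂ)) * (μ.parts.map tVar).prod := by
  rw [cycPoly, Finset.mul_sum]
  refine Finset.sum_congr rfl fun μ _ => ?_
  rw [← mul_assoc]
  congr 1
  have h1 : (centralizerOrder μ.parts : ℂ) ≠ 0 :=
    Nat.cast_ne_zero.2 (centralizerOrder_ne_zero (Partition.zero_notMem μ))
  have h2 : (k.factorial : ℂ) ≠ 0 := Nat.cast_ne_zero.2 k.factorial_ne_zero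
  have h3 : (conjClassCard μ : ℂ) * centralizerOrder μ.parts = k.factorial := by
    exact_mod_cast conjClassCard_mul_centralizerOrder μ
  rw [← map_natCast (MvPolynomial.C : ℂ →+* TPoly), ← map_mul]
  congr 1
  field_simp
  exact h3

theorem cycPoly_zero : cycPoly 0 = 1 := by
  rw [cycPoly_eq_sum, Fintype.sum_unique]
  simp [centralizerOrder]

theorem sum_mul_count_parts {k : ℕ} (μ : k.Partition) :
    ∑ j ∈ Finset.Icc 1 k, j * μ.parts.count j = k := by
  conv_rhs => rw [← μ.parts_sum, Finset.sum_multiset_count]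
  symm
  refine (Finset.sum_subset ?_ fun j _ hj => ?_).trans
    (Finset.sum_congr rfl fun j _ => by rw [smul_eq_mul, mul_comm])
  · intro j hj
    have hj' := Multiset.mem_toFinset.1 hj
    exact Finset.mem_Icc.2 ⟨μ.parts_pos hj', μ.le_of_mem_parts hj'⟩
  · rw [Multiset.count_eq_zero_of_notMem (by simpa using hj), zero_smul]

/-- Removing a part `j` from the partitions of `k`. -/
theorem sum_partition_mul_count {k j : ℕ} (hj1 : 1 ≤ j) (hj : j ≤ k) :
    ∑ μ : k.Partition, MvPolynomial.C ((j * μ.parts.count j : ℕ) / (centralizerOrder μ.parts : ℂ)) *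
      (μ.parts.map tVar).prod = tVar j * cycPoly (k - j) := by
  set F : k.Partition → TPoly := fun μ =>
    MvPolynomial.C ((j * μ.parts.count j : ℕ) / (centralizerOrder μ.parts : ℂ)) *
      (μ.parts.map tVar).prod with hF
  have h1 : ∑ μ : k.Partition, F μ = ∑ μ : {μ : k.Partition // j ∈ μ.parts}, F μ := by
    rw [← Finset.sum_subtype (Finset.univ.filter fun μ : k.Partition => j ∈ μ.parts)
      (fun μ => by simp) F]
    refine (Finset.sum_subset (Finset.filter_subset _ _) fun μ _ hμ => ?_).symm
    have : j ∉ μ.parts := by simpa using hμ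
    simp [hF, Multiset.count_eq_zero_of_notMem this]
  rw [h1, ← (Nat.Partition.partitionWithPartEquiv hj1 hj).symm.sum_comp, cycPoly_eq_sum,
    Finset.mul_sum]
  refine Finset.sum_congr rfl fun ν _ => ?_
  rw [hF]
  simp only [Nat.Partition.partitionWithPartEquiv_symm_apply_parts, centralizerOrder_cons,
    Multiset.count_cons_self, Multiset.map_cons, Multiset.prod_cons]
  have h2 : ((j * (ν.parts.count j + 1) : ℕ) : ℂ) ≠ 0 :=
    Nat.cast_ne_zero.2 (mul_ne_zero (by omega) (Nat.succ_ne_zero _))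
  have h3 : ((j * (ν.parts.count j + 1) : ℕ) : ℂ) /
      ((j * (ν.parts.count j + 1) * centralizerOrder ν.parts : ℕ) : ℂ) =
      1 / (centralizerOrder ν.parts : ℂ) := by
    rw [Nat.cast_mul (j * (ν.parts.count j + 1)), ← div_div, div_self h2]
  rw [h3]
  ring

/-- The cycle index recursion `k Cyc_k = ∑_{1 ≤ j ≤ k} t_j Cyc_{k-j}`: the parts of a partition of
`k` add up to `k`. -/
theorem natCast_mul_cycPoly (k : ℕ) :
    (k : TPoly) * cycPoly k =
      ∑ j ∈ Finset.range k, cycPoly (k - (j + 1)) * MvPolynomial.X j.succPNat := by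
  simp only [mul_comm (cycPoly _), ← tVar_succ]
  rw [Finset.range_eq_Ico, Finset.sum_Ico_add' (fun j => tVar j * cycPoly (k - j)) 0 k 1, zero_add,
    Finset.Ico_add_one_right_eq_Icc]
  have h : ∀ j ∈ Finset.Icc 1 k, tVar j * cycPoly (k - j) = _ := fun j hj =>
    (sum_partition_mul_count (Finset.mem_Icc.1 hj).1 (Finset.mem_Icc.1 hj).2).symm
  rw [Finset.sum_congr rfl h, Finset.sum_comm, cycPoly_eq_sum, Finset.mul_sum]
  refine Finset.sum_congr rfl fun μ _ => ?_
  rw [← Finset.sum_mul, ← map_sum, ← Finset.sum_div, ← Nat.cast_sum, sum_mul_count_parts,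
    ← mul_assoc, ← map_natCast (MvPolynomial.C : ℂ →+* TPoly), ← map_mul, mul_one_div]

theorem skew_zero (P : TPoly) : skew 0 P = P := by
  have h : ((Polynomial.constantCoeff).comp (shift : TPoly →+* Polynomial TPoly)) =
      RingHom.id TPoly := by
    refine MvPolynomial.ringHom_ext (fun c => ?_) fun j => ?_
    · simp
    · simp [shift_X, j.ne_zero.symm]
  exact congrArg (fun φ : TPoly →+* TPoly => φ P) h

/-- Up to order `N` in `x`, the operator `x d/dx` acts on a translate as `∑_j x^j ∂/∂t_j`. -/
theorem X_pow_dvd_derivative_shift (N : ℕ) (P : TPoly) :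
    (Polynomial.X : Polynomial TPoly) ^ (N + 1) ∣
      Polynomial.X * Polynomial.derivative (shift P) -
        ∑ j ∈ Finset.range N,
          Polynomial.X ^ (j + 1) * shift (MvPolynomial.pderiv j.succPNat P) := by
  induction P using MvPolynomial.induction_on with
  | C c => simp
  | add P Q hP hQ =>
    refine (dvd_add hP hQ).trans (dvd_of_eq ?_)
    simp only [map_add, mul_add, Finset.sum_add_distrib]
    ring
  | mul_X P i hP =>
    have hX : (Polynomial.X : Polynomial TPoly) ^ (N + 1) ∣
        Polynomial.X * Polynomial.derivative (shift (MvPolynomial.X i)) -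
          ∑ j ∈ Finset.range N, Polynomial.X ^ (j + 1) *
            shift (MvPolynomial.pderiv j.succPNat (MvPolynomial.X i)) := by
      have h1 : Polynomial.X * Polynomial.derivative (shift (MvPolynomial.X i)) =
          Polynomial.X ^ (i : ℕ) := by
        have h2 := C_C_one_div_mul_natCast i.ne_zero
        have h3 : (Polynomial.X : Polynomial TPoly) * Polynomial.X ^ ((i : ℕ) - 1) =
            Polynomial.X ^ (i : ℕ) := by
          rw [← pow_succ', Nat.sub_add_cancel i.pos]
        rw [shift_X, Polynomial.derivative_add, Polynomial.derivative_C, zero_add,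
          Polynomial.derivative_C_mul_X_pow, map_mul, ← h3]
        simp only [map_natCast]
        linear_combination Polynomial.X * Polynomial.X ^ ((i : ℕ) - 1) * h2
      have h2 : ∀ j ∈ Finset.range N, (Polynomial.X : Polynomial TPoly) ^ (j + 1) *
          shift (MvPolynomial.pderiv j.succPNat (MvPolynomial.X i)) =
          if j = (i : ℕ) - 1 then Polynomial.X ^ (i : ℕ) else 0 := by
        intro j _
        have hji : i = j.succPNat ↔ j = (i : ℕ) - 1 := by
          rw [← PNat.coe_inj, Nat.succPNat_coe]
          have := i.pos
          omega
        split_ifs with h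
        · rw [← hji] at h
          subst h
          simp
        · rw [← hji] at h
          rw [MvPolynomial.pderiv_X_of_ne h, map_zero, mul_zero]
      rw [h1, Finset.sum_congr rfl h2, Finset.sum_ite_eq']
      split_ifs with h
      · simp
      · rw [sub_zero]
        rw [Finset.mem_range] at h
        refine pow_dvd_pow _ ?_
        have := i.pos
        omega
    -- The difference is a derivation along the translation.
    refine (dvd_add (hP.mul_right (shift (MvPolynomial.X i))) (hX.mul_left (shift P))).trans
      (dvd_of_eq ?_)
    simp only [map_mul, Polynomial.derivative_mul, Derivation.leibniz, smul_eq_mul, map_add,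
      mul_add, Finset.sum_add_distrib, sub_mul, mul_sub, Finset.sum_mul, Finset.mul_sum]
    have e1 : ∀ j, shift P * (Polynomial.X ^ (j + 1) *
        shift (MvPolynomial.pderiv j.succPNat (MvPolynomial.X i))) = Polynomial.X ^ (j + 1) *
        (shift P * shift (MvPolynomial.pderiv j.succPNat (MvPolynomial.X i))) := fun j => by ring
    have e2 : ∀ j, Polynomial.X ^ (j + 1) * shift (MvPolynomial.pderiv j.succPNat P) *
        shift (MvPolynomial.X i) = Polynomial.X ^ (j + 1) *
        (shift (MvPolynomial.X i) * shift (MvPolynomial.pderiv j.succPNat P)) := fun j => by ring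
    simp only [e1, e2]
    ring

/-- The analogue of `natCast_mul_cycPoly` for the skewing operators. -/
theorem natCast_mul_skew (k : ℕ) (P : TPoly) :
    (k : TPoly) * skew k P =
      ∑ j ∈ Finset.range k, skew (k - (j + 1)) (MvPolynomial.pderiv j.succPNat P) := by
  have h := Polynomial.X_pow_dvd_iff.1 (X_pow_dvd_derivative_shift k P) k k.lt_succ_self
  rw [Polynomial.coeff_sub, sub_eq_zero, Polynomial.finsetSum_coeff] at h
  have h2 : (Polynomial.X * Polynomial.derivative (shift P)).coeff k = (k : TPoly) * skew k P := by
    cases k with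
    | zero => simp
    | succ k =>
      rw [Polynomial.coeff_X_mul, Polynomial.coeff_derivative, skew_apply]
      push_cast
      ring
  rw [← h2, h]
  refine Finset.sum_congr rfl fun j hj => ?_
  rw [Polynomial.coeff_X_pow_mul', if_pos (Nat.succ_le_of_lt (Finset.mem_range.1 hj)), skew_apply]

/-! ### Gaussian moments -/

/-- The integrand `z^a z̄^b e^{-|z|²}` of a complex Gaussian moment. -/
def momentIntegrand (a b : ℕ) (z : ℂ) : ℂ :=
  z ^ a * (starRingEnd ℂ z) ^ b * ((Real.exp (-‖z‖ ^ 2) : ℝ) : ℂ)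

theorem integral_norm_pow_mul_exp (q : ℕ) :
    ∫ z : ℂ, ‖z‖ ^ q * Real.exp (-‖z‖ ^ 2) = Real.pi * Real.Gamma ((q + 2) / 2) := by
  have h := Complex.integral_rpow_mul_exp_neg_rpow (p := 2) (q := q) (by norm_num)
    (by have := q.cast_nonneg (α := ℝ); linarith)
  simp only [Real.rpow_natCast, Real.rpow_two] at h
  rw [h]
  ring

theorem integrable_norm_pow_mul_exp (q : ℕ) :
    MeasureTheory.Integrable fun z : ℂ => ‖z‖ ^ q * Real.exp (-‖z‖ ^ 2) := by
  -- The integral of a function that is not integrable would be `0`.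
  by_contra h
  have h1 := integral_norm_pow_mul_exp q
  rw [MeasureTheory.integral_undef h] at h1
  exact (mul_pos Real.pi_pos (Real.Gamma_pos_of_pos (by positivity))).ne h1

theorem integrable_momentIntegrand (a b : ℕ) :
    MeasureTheory.Integrable (momentIntegrand a b) := by
  refine (integrable_norm_pow_mul_exp (a + b)).mono' ?_ (Filter.Eventually.of_forall fun z => ?_)
  · refine Continuous.aestronglyMeasurable ?_
    unfold momentIntegrand
    fun_prop
  · rw [momentIntegrand, norm_mul, norm_mul, norm_pow, norm_pow, RCLike.norm_conj, ← pow_add,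
      Complex.norm_real, Real.norm_of_nonneg (Real.exp_pos _).le]

theorem integral_momentIntegrand_self (a : ℕ) :
    ∫ z, momentIntegrand a a z = Real.pi * a.factorial := by
  have h : ∀ z, momentIntegrand a a z = ((‖z‖ ^ (2 * a) * Real.exp (-‖z‖ ^ 2) : ℝ) : ℂ) := by
    intro z
    rw [momentIntegrand, ← mul_pow, Complex.mul_conj, Complex.normSq_eq_norm_sq]
    push_cast
    ring
  simp only [h]
  rw [integral_complex_ofReal, integral_norm_pow_mul_exp,
    show (((2 * a : ℕ) : ℝ) + 2) / 2 = (a : ℝ) + 1 by push_cast; ring,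
    Real.Gamma_nat_eq_factorial]
  push_cast
  rfl

/-- For `a ≠ b` a suitable rotation changes the sign of `z^a z̄^b`. -/
theorem integral_momentIntegrand_of_ne {a b : ℕ} (hab : a ≠ b) :
    ∫ z, momentIntegrand a b z = 0 := by
  have hd : (a : ℝ) - b ≠ 0 := sub_ne_zero.2 (Nat.cast_injective.ne hab)
  set u : Circle := Circle.exp (Real.pi / (a - b)) with hu
  have hu' : (u : ℂ) ^ a * (starRingEnd ℂ (u : ℂ)) ^ b = -1 := by
    have hd' : (a : ℂ) - b ≠ 0 := by exact_mod_cast hd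
    rw [hu, Circle.coe_exp, ← Complex.exp_conj, ← Complex.exp_nat_mul, ← Complex.exp_nat_mul,
      ← Complex.exp_add, ← Complex.exp_pi_mul_I]
    congr 1
    simp only [map_mul, Complex.conj_ofReal, Complex.conj_I]
    push_cast
    field_simp
    ring
  have h1 := (rotation u).measurePreserving.integral_comp
    (rotation u).toHomeomorph.measurableEmbedding (momentIntegrand a b)
  have h2 : ∀ z, momentIntegrand a b (rotation u z) = -momentIntegrand a b z := by
    intro z
    rw [momentIntegrand, momentIntegrand, rotation_apply, norm_mul, Circle.norm_coe, one_mul,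
      map_mul, mul_pow, mul_pow]
    linear_combination (z ^ a * (starRingEnd ℂ z) ^ b * ((Real.exp (-‖z‖ ^ 2) : ℝ) : ℂ)) * hu'
  simp only [h2, MeasureTheory.integral_neg] at h1
  exact self_eq_neg.1 h1.symm

/-! ### The Gaussian pairing -/

/-- The exponents of `t₁, …, t_r` in the monomial with exponent vector `a`. -/
def cropExponent (r : ℕ) (a : ℕ+ →₀ ℕ) (i : Fin r) : ℕ := a (i : ℕ).succPNat

/-- The monomial with exponent vector `a` involves only `t₁, …, t_r`. -/
def IsCropped (r : ℕ) (a : ℕ+ →₀ ℕ) : Prop := ∀ j ∈ a.support, (j : ℕ) ≤ r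

theorem crop_succPNat {r : ℕ} (t : Fin r → ℂ) (i : Fin r) : crop t (i : ℕ).succPNat = t i := by
  simp [crop]

theorem crop_of_lt {r : ℕ} (t : Fin r → ℂ) {j : ℕ+} (h : r < j) : crop t j = 0 :=
  dif_neg (by omega)

theorem evalCrop_monomial_of_isCropped {r : ℕ} (t : Fin r → ℂ) {a : ℕ+ →₀ ℕ} (h : IsCropped r a)
    (c : ℂ) : evalCrop t (MvPolynomial.monomial a c) = c * ∏ i, t i ^ cropExponent r a i := by
  rw [evalCrop, MvPolynomial.eval_monomial]
  congr 1
  have hinj : Function.Injective fun i : Fin r => (i : ℕ).succPNat := fun i j hij =>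
    Fin.ext (Nat.succPNat_injective hij)
  rw [Finsupp.prod_of_support_subset a (s := Finset.univ.map ⟨_, hinj⟩) _ _ fun j _ => pow_zero _]
  · rw [Finset.prod_map]
    exact Finset.prod_congr rfl fun i _ => by
      simp only [Function.Embedding.coeFn_mk]
      rw [crop_succPNat]; rfl
  · intro j hj
    have h1 := h j hj
    have h2 := j.pos
    refine Finset.mem_map.2 ⟨⟨(j : ℕ) - 1, by omega⟩, Finset.mem_univ _, ?_⟩
    exact PNat.coe_injective (Nat.sub_add_cancel h2)

theorem evalCrop_monomial_of_not_isCropped {r : ℕ} (t : Fin r → ℂ) {a : ℕ+ →₀ ℕ}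
    (h : ¬ IsCropped r a) (c : ℂ) : evalCrop t (MvPolynomial.monomial a c) = 0 := by
  simp only [IsCropped, not_forall, not_le] at h
  obtain ⟨j, hj, hr⟩ := h
  rw [evalCrop, MvPolynomial.eval_monomial, Finsupp.prod, Finset.prod_eq_zero hj, mul_zero]
  rw [crop_of_lt t hr, zero_pow (Finsupp.mem_support_iff.1 hj)]

theorem evalCrop_add {r : ℕ} (t : Fin r → ℂ) (P Q : TPoly) :
    evalCrop t (P + Q) = evalCrop t P + evalCrop t Q := map_add _ _ _

/-- The integrand `P(t) conj(Q(t)) ∏ e^{-|t_j|²}` of the Gaussian pairing, at the cropped point. -/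
def pairingIntegrand (r : ℕ) (P Q : TPoly) (t : Fin r → ℂ) : ℂ :=
  evalCrop t P * starRingEnd ℂ (evalCrop t Q) * gaussWeight t

theorem pairingIntegrand_add_left (r : ℕ) (P P' Q : TPoly) :
    pairingIntegrand r (P + P') Q = pairingIntegrand r P Q + pairingIntegrand r P' Q := by
  ext t
  simp only [pairingIntegrand, evalCrop_add, Pi.add_apply]
  ring

theorem pairingIntegrand_add_right (r : ℕ) (P Q Q' : TPoly) :
    pairingIntegrand r P (Q + Q') = pairingIntegrand r P Q + pairingIntegrand r P Q' := by
  ext t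
  simp only [pairingIntegrand, evalCrop_add, Pi.add_apply, map_add]
  ring

theorem pairingIntegrand_monomial {r : ℕ} {a b : ℕ+ →₀ ℕ} (ha : IsCropped r a)
    (hb : IsCropped r b) (c d : ℂ) :
    pairingIntegrand r (MvPolynomial.monomial a c) (MvPolynomial.monomial b d) =
      fun t => c * starRingEnd ℂ d *
        ∏ i, momentIntegrand (cropExponent r a i) (cropExponent r b i) (t i) := by
  ext t
  simp only [pairingIntegrand, evalCrop_monomial_of_isCropped t ha,
    evalCrop_monomial_of_isCropped t hb, gaussWeight, momentIntegrand, Finset.prod_mul_distrib,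
    map_mul, map_prod, map_pow]
  ring

theorem pairingIntegrand_monomial_of_not {r : ℕ} {a b : ℕ+ →₀ ℕ}
    (h : ¬ (IsCropped r a ∧ IsCropped r b)) (c d : ℂ) :
    pairingIntegrand r (MvPolynomial.monomial a c) (MvPolynomial.monomial b d) = 0 := by
  ext t
  rw [pairingIntegrand]
  by_cases ha : IsCropped r a
  · rw [evalCrop_monomial_of_not_isCropped t (fun hb => h ⟨ha, hb⟩)]; simp
  · rw [evalCrop_monomial_of_not_isCropped t ha]; simp

theorem integrable_pairingIntegrand (r : ℕ) (P Q : TPoly) :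
    MeasureTheory.Integrable (pairingIntegrand r P Q) := by
  induction P using MvPolynomial.induction_on' with
  | add P P' hP hP' => rw [pairingIntegrand_add_left]; exact hP.add hP'
  | monomial a c =>
    induction Q using MvPolynomial.induction_on' with
    | add Q Q' hQ hQ' => rw [pairingIntegrand_add_right]; exact hQ.add hQ'
    | monomial b d =>
      by_cases h : IsCropped r a ∧ IsCropped r b
      · rw [pairingIntegrand_monomial h.1 h.2]
        exact (MeasureTheory.Integrable.fintype_prod fun i =>
          integrable_momentIntegrand _ _).const_mul _
      · rw [pairingIntegrand_monomial_of_not h]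
        exact MeasureTheory.integrable_zero _ _ _

/-- The Gaussian pairing `π^{-r} ∫ P conj(Q) ∏ e^{-|t_j|²}` of two polynomials in `t₁, …, t_r`. -/
def pairing (r : ℕ) (P Q : TPoly) : ℂ :=
  (1 / (Real.pi : ℂ) ^ r) * ∫ t, pairingIntegrand r P Q t

theorem pairing_add_left (r : ℕ) (P P' Q : TPoly) :
    pairing r (P + P') Q = pairing r P Q + pairing r P' Q := by
  simp only [pairing, pairingIntegrand_add_left, Pi.add_apply]
  rw [MeasureTheory.integral_add (integrable_pairingIntegrand r P Q)
    (integrable_pairingIntegrand r P' Q), mul_add]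

theorem pairing_add_right (r : ℕ) (P Q Q' : TPoly) :
    pairing r P (Q + Q') = pairing r P Q + pairing r P Q' := by
  simp only [pairing, pairingIntegrand_add_right, Pi.add_apply]
  rw [MeasureTheory.integral_add (integrable_pairingIntegrand r P Q)
    (integrable_pairingIntegrand r P Q'), mul_add]

theorem pairing_zero_left (r : ℕ) (Q : TPoly) : pairing r 0 Q = 0 := by
  simpa using pairing_add_left r 0 0 Q

theorem pairing_sum_left {ι : Type*} (r : ℕ) (s : Finset ι) (P : ι → TPoly) (Q : TPoly) :
    pairing r (∑ i ∈ s, P i) Q = ∑ i ∈ s, pairing r (P i) Q :=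
  map_sum (AddMonoidHom.mk' (fun P => pairing r P Q) fun P P' => pairing_add_left r P P' Q) P s

theorem pairing_sum_right {ι : Type*} (r : ℕ) (s : Finset ι) (P : TPoly) (Q : ι → TPoly) :
    pairing r P (∑ i ∈ s, Q i) = ∑ i ∈ s, pairing r P (Q i) :=
  map_sum (AddMonoidHom.mk' (fun Q => pairing r P Q) fun Q Q' => pairing_add_right r P Q Q') Q s

theorem pairing_natCast_mul_left (r k : ℕ) (P Q : TPoly) :
    pairing r (k * P) Q = k * pairing r P Q := by
  rw [← nsmul_eq_mul, ← nsmul_eq_mul]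
  exact map_nsmul (AddMonoidHom.mk' (fun P => pairing r P Q) fun P P' =>
    pairing_add_left r P P' Q) k P

theorem pairing_natCast_mul_right (r k : ℕ) (P Q : TPoly) :
    pairing r P (k * Q) = k * pairing r P Q := by
  rw [← nsmul_eq_mul, ← nsmul_eq_mul]
  exact map_nsmul (AddMonoidHom.mk' (fun Q => pairing r P Q) fun Q Q' =>
    pairing_add_right r P Q Q') k Q

theorem pairing_monomial {r : ℕ} {a b : ℕ+ →₀ ℕ} (ha : IsCropped r a) (hb : IsCropped r b)
    (c d : ℂ) : pairing r (MvPolynomial.monomial a c) (MvPolynomial.monomial b d) =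
      c * starRingEnd ℂ d * ∏ i, if cropExponent r a i = cropExponent r b i then
        ((cropExponent r a i).factorial : ℂ) else 0 := by
  have h : ∀ i : Fin r, ∫ z, momentIntegrand (cropExponent r a i) (cropExponent r b i) z =
      Real.pi * if cropExponent r a i = cropExponent r b i then
        ((cropExponent r a i).factorial : ℂ) else 0 := by
    intro i
    split_ifs with h
    · rw [← h, integral_momentIntegrand_self]
    · rw [integral_momentIntegrand_of_ne h, mul_zero]
  have hpi : (Real.pi : ℂ) ^ r ≠ 0 := pow_ne_zero _ (Complex.ofReal_ne_zero.2 Real.pi_ne_zero)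
  rw [pairing, pairingIntegrand_monomial ha hb, MeasureTheory.integral_const_mul,
    MeasureTheory.integral_fintype_prod_volume_eq_prod
      (fun i : Fin r => momentIntegrand (cropExponent r a i) (cropExponent r b i)),
    Finset.prod_congr rfl fun i _ => h i, Finset.prod_mul_distrib, Finset.prod_const,
    Finset.card_univ, Fintype.card_fin]
  field_simp

theorem pairing_monomial_of_not {r : ℕ} {a b : ℕ+ →₀ ℕ}
    (h : ¬ (IsCropped r a ∧ IsCropped r b)) (c d : ℂ) :
    pairing r (MvPolynomial.monomial a c) (MvPolynomial.monomial b d) = 0 := by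
  simp [pairing, pairingIntegrand_monomial_of_not h]

theorem isCropped_add_single {r : ℕ} {a : ℕ+ →₀ ℕ} {j : ℕ+} (hj : (j : ℕ) ≤ r) :
    IsCropped r (a + Finsupp.single j 1) ↔ IsCropped r a := by
  constructor
  · intro h i hi
    refine h i (Finsupp.mem_support_iff.2 ?_)
    have := Finsupp.mem_support_iff.1 hi
    rw [Finsupp.add_apply]
    omega
  · intro h i hi
    by_cases hij : i = j
    · exact hij ▸ hj
    · refine h i (Finsupp.mem_support_iff.2 ?_)
      have := Finsupp.mem_support_iff.1 hi
      rwa [Finsupp.add_apply, Finsupp.single_eq_of_ne hij, add_zero] at this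

/-- Multiplication by `t_{i+1}` is adjoint to `∂/∂t_{i+1}`. -/
theorem pairing_mul_X (r : ℕ) (i : Fin r) (P Q : TPoly) :
    pairing r P (Q * MvPolynomial.X (i : ℕ).succPNat) =
      pairing r (MvPolynomial.pderiv (i : ℕ).succPNat P) Q := by
  set j := (i : ℕ).succPNat with hj
  have hjr : (j : ℕ) ≤ r := by simp [hj]
  induction P using MvPolynomial.induction_on' with
  | add P P' hP hP' => rw [pairing_add_left, hP, hP', map_add, pairing_add_left]
  | monomial a c =>
    induction Q using MvPolynomial.induction_on' with
    | add Q Q' hQ hQ' => rw [add_mul, pairing_add_right, hQ, hQ', pairing_add_right]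
    | monomial b d =>
      rw [MvPolynomial.X, MvPolynomial.monomial_mul, mul_one, MvPolynomial.pderiv_monomial]
      have hother : ∀ (a : ℕ+ →₀ ℕ) (k : Fin r), k ∈ Finset.univ.erase i →
          cropExponent r (a + Finsupp.single j 1) k = cropExponent r a k := by
        intro a k hk
        have : (k : ℕ).succPNat ≠ j := fun h => Finset.ne_of_mem_erase hk
          (Fin.ext (Nat.succPNat_injective h))
        rw [cropExponent, Finsupp.add_apply, Finsupp.single_eq_of_ne this]; rfl
      have hself : ∀ a : ℕ+ →₀ ℕ,
          cropExponent r (a + Finsupp.single j 1) i = cropExponent r a i + 1 := by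
        intro a
        rw [cropExponent, Finsupp.add_apply, ← hj, Finsupp.single_eq_same, hj]; rfl
      by_cases haj : a j = 0
      · rw [haj, Nat.cast_zero, mul_zero, map_zero, pairing_zero_left]
        by_cases h : IsCropped r a ∧ IsCropped r (b + Finsupp.single j 1)
        · rw [pairing_monomial h.1 h.2, Finset.prod_eq_zero (Finset.mem_univ i), mul_zero]
          have : cropExponent r a i = 0 := haj
          rw [hself, if_neg (by omega)]
        · exact pairing_monomial_of_not h _ _
      · obtain ⟨a, rfl⟩ : ∃ a', a = a' + Finsupp.single j 1 :=
          ⟨a - Finsupp.single j 1, (tsub_add_cancel_of_le (Finsupp.single_le_iff.2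
            (Nat.one_le_iff_ne_zero.2 haj))).symm⟩
        rw [add_tsub_cancel_right]
        by_cases h : IsCropped r a ∧ IsCropped r b
        · rw [pairing_monomial ((isCropped_add_single hjr).2 h.1)
            ((isCropped_add_single hjr).2 h.2), pairing_monomial h.1 h.2,
            ← Finset.mul_prod_erase _ _ (Finset.mem_univ i),
            ← Finset.mul_prod_erase _ (fun k => if cropExponent r a k = cropExponent r b k then
              ((cropExponent r a k).factorial : ℂ) else 0) (Finset.mem_univ i)]
          have e : ∀ k ∈ Finset.univ.erase i,
              (if cropExponent r (a + Finsupp.single j 1) k =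
                cropExponent r (b + Finsupp.single j 1) k then
                ((cropExponent r (a + Finsupp.single j 1) k).factorial : ℂ) else 0) =
              if cropExponent r a k = cropExponent r b k then
                ((cropExponent r a k).factorial : ℂ) else 0 := by
            intro k hk
            rw [hother a k hk, hother b k hk]
          rw [Finset.prod_congr rfl e, hself, hself]
          have haj' : (a + Finsupp.single j 1 : ℕ+ →₀ ℕ) j = cropExponent r a i + 1 := hself a
          rw [haj']
          by_cases hi : cropExponent r a i = cropExponent r b i
          · rw [if_pos (by omega), if_pos hi, Nat.factorial_succ]
            push_cast
            ring
          · rw [if_neg (by omega), if_neg hi]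
            ring
        · rw [pairing_monomial_of_not h, pairing_monomial_of_not]
          rwa [isCropped_add_single hjr, isCropped_add_single hjr]

/-- The Gaussian average of a polynomial in the `t_j` alone is its value at `0`. -/
theorem pairing_one_right (r : ℕ) (P : TPoly) :
    pairing r P 1 = MvPolynomial.constantCoeff P := by
  have h0 : IsCropped r 0 := fun j hj => by simp at hj
  induction P using MvPolynomial.induction_on' with
  | add P P' hP hP' => rw [pairing_add_left, hP, hP', map_add]
  | monomial a c =>
    rw [MvPolynomial.constantCoeff_monomial]
    split_ifs with ha
    · rw [ha]
      rw [show (1 : TPoly) = MvPolynomial.monomial 0 1 from rfl, pairing_monomial h0 h0]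
      simp [cropExponent]
    · rw [show (1 : TPoly) = MvPolynomial.monomial 0 1 from rfl]
      by_cases h : IsCropped r a
      · obtain ⟨j, hj⟩ := Finsupp.support_nonempty_iff.2 ha
        have h1 := h j hj
        have h2 := j.pos
        rw [pairing_monomial h h0, Finset.prod_eq_zero
          (Finset.mem_univ (⟨(j : ℕ) - 1, by omega⟩ : Fin r)), mul_zero]
        have h3 : ((j : ℕ) - 1).succPNat = j := PNat.coe_injective (Nat.sub_add_cancel h2)
        rw [cropExponent, cropExponent, h3, Finsupp.zero_apply,
          if_neg (Finsupp.mem_support_iff.1 hj)]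
      · exact pairing_monomial_of_not (fun h' => h h'.1) _ _

/-- Multiplication by the cycle index is adjoint to skewing, since the recursions for `Cyc_k` and
`skew k` are adjoint to each other. The bound `k ≤ r` ensures that no cropped variable occurs in
`Cyc_k`. -/
theorem pairing_mul_cycPoly {r k : ℕ} (hk : k ≤ r) (P Q : TPoly) :
    pairing r P (Q * cycPoly k) = pairing r (skew k P) Q := by
  induction k using Nat.strong_induction_on generalizing P Q with
  | _ k ih =>
    cases k with
    | zero => rw [cycPoly_zero, mul_one, skew_zero]
    | succ k =>
      refine mul_left_cancel₀ (Nat.cast_ne_zero.2 k.succ_ne_zero : ((k + 1 : ℕ) : ℂ) ≠ 0) ?_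
      rw [← pairing_natCast_mul_right, ← pairing_natCast_mul_left, natCast_mul_skew,
        pairing_sum_left, mul_left_comm, natCast_mul_cycPoly, Finset.mul_sum, pairing_sum_right]
      refine Finset.sum_congr rfl fun j hj => ?_
      have hj := Finset.mem_range.1 hj
      rw [← mul_assoc, pairing_mul_X r ⟨j, by omega⟩, ih (k + 1 - (j + 1)) (by omega) (by omega)]

theorem pairing_cycPoly_pow (r n : ℕ) (P : TPoly) :
    pairing r P (cycPoly r ^ n) = MvPolynomial.constantCoeff ((skew r)^[n] P) := by
  induction n generalizing P with
  | zero => rw [pow_zero, pairing_one_right]; rfl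
  | succ n ih => rw [pow_succ, pairing_mul_cycPoly le_rfl, ih, Function.iterate_succ_apply]

/-! ### The Gaussian integral -/

theorem coeff_exp_subst_C_mul_X_pow {r : ℕ} (hr : 1 ≤ r) (c : ℂ) (l : ℕ) :
    PowerSeries.coeff l ((PowerSeries.exp ℂ).subst
      (PowerSeries.C c * (PowerSeries.X : ℂ⟦X⟧) ^ r)) =
        if r ∣ l then c ^ (l / r) / ((l / r).factorial : ℂ) else 0 := by
  have hcoeff : ∀ d, PowerSeries.coeff l
      ((PowerSeries.C c * (PowerSeries.X : ℂ⟦X⟧) ^ r) ^ d) = if l = r * d then c ^ d else 0 := by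
    intro d
    rw [mul_pow, ← map_pow, PowerSeries.coeff_C_mul, ← pow_mul, PowerSeries.coeff_X_pow]
    simp
  rw [PowerSeries.coeff_subst' (hasSubst_C_mul_X_pow hr c)]
  simp only [hcoeff]
  split_ifs with h
  · obtain ⟨d, rfl⟩ := h
    rw [Nat.mul_div_cancel_left d hr, finsum_eq_single _ d]
    · simp [div_eq_inv_mul]
    · intro d' hd'
      rw [if_neg fun h => hd' (Nat.eq_of_mul_eq_mul_left hr h).symm, smul_zero]
  · refine finsum_eq_zero_of_forall_eq_zero fun d => ?_
    rw [if_neg fun h' => h ⟨d, h'⟩, smul_zero]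

theorem coeff_integrand {r : ℕ} (hr : 1 ≤ r) (μ : YoungDiagram) (l : ℕ) (t : Fin r → ℂ) :
    PowerSeries.coeff l (integrand μ t) * gaussWeight t =
      if r ∣ l then (1 / ((l / r).factorial : ℂ)) *
        pairingIntegrand r (schurPoly μ) (cycPoly r ^ (l / r)) t else 0 := by
  rw [integrand, PowerSeries.coeff_C_mul, expConjCyc, coeff_exp_subst_C_mul_X_pow hr]
  split_ifs with h
  · rw [pairingIntegrand, evalCrop, evalCrop, evalCrop, map_pow, map_pow]
    ring
  · ring

/-- For `l = r n` with `|μ| ≠ l` the value is `0`, because no tableau has the required content. -/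
theorem coeff_gaussIntegral_integrand {r : ℕ} (hr : 1 ≤ r) (μ : YoungDiagram) (l : ℕ) :
    PowerSeries.coeff l (gaussIntegral (r := r) fun t => integrand μ t) =
      if r ∣ l then (rectKostka μ r (l / r) : ℂ) / ((l / r).factorial : ℂ) else 0 := by
  rw [gaussIntegral, PowerSeries.coeff_mk]
  simp only [coeff_integrand hr]
  split_ifs with h
  · rw [MeasureTheory.integral_const_mul, mul_left_comm, ← pairing, pairing_cycPoly_pow,
      constantCoeff_iterate_skew_schurPoly]
    ring
  · simp

end LabelCropping

end

theorem mainTheorem4 (r : ℕ) (hr : 1 ≤ r) (μ : YoungDiagram) :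
    LabelCropping.GaussIntegrable (r := r) (fun t => LabelCropping.integrand μ t) ∧
    (∀ n : ℕ, μ.card = r * n →
      LabelCropping.gaussIntegral (r := r) (fun t => LabelCropping.integrand μ t) =
        PowerSeries.monomial (r * n)
          ((LabelCropping.rectKostka μ r n : ℂ) / (n.factorial : ℂ))) ∧
    (¬ r ∣ μ.card →
      LabelCropping.gaussIntegral (r := r) (fun t => LabelCropping.integrand μ t) = 0) := by
  refine ⟨fun l => ?_, fun n hn => ?_, fun h => ?_⟩
  · simp only [LabelCropping.coeff_integrand hr]
    split_ifs with h
    · exact (LabelCropping.integrable_pairingIntegrand r _ _).const_mul _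
    · exact MeasureTheory.integrable_zero _ _ _
  · ext l
    rw [LabelCropping.coeff_gaussIntegral_integrand hr, PowerSeries.coeff_monomial]
    by_cases hl : l = r * n
    · rw [if_pos hl, hl, if_pos (dvd_mul_right r n), Nat.mul_div_cancel_left n hr]
    · rw [if_neg hl]
      split_ifs with hd
      · obtain ⟨d, rfl⟩ := hd
        rw [Nat.mul_div_cancel_left d hr, LabelCropping.rectKostka_eq_zero, Nat.cast_zero, zero_div]
        rw [hn]
        exact fun h => hl h.symm
      · rfl
  · ext l
    rw [LabelCropping.coeff_gaussIntegral_integrand hr, map_zero]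
    split_ifs with hd
    · rw [LabelCropping.rectKostka_eq_zero fun h' => h ⟨_, h'⟩, Nat.cast_zero, zero_div]
    · rfl
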